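/- Let $R$ be a finite union of closed faces of the plane divided either into unit squares (the quadriculated case) or into unit equilateral triangles (the triangulated case), and suppose that $R$, as a subset of the plane, is simply connected (hence nonempty and path connected). Colour the faces of the plane black and white so that faces with a common side have different colours, and suppose that $R$ contains as many black faces as white faces, $n$ of each. Let $\Lambda$ be the graph whose vertices are the $2n$ faces of $R$, two of them being joined by an edge iff they have a common side. Label the faces, black ones first, so that the adjacency matrix of $\Lambda$ is $$A=\begin{pmatrix}0&B\\B^{t}&0\end{pmatrix}$$ with $B$ an $n\times n$ matrix. A tiling of $R$ is a partition of its faces into tiles, a tile being the union of two faces with a common side (a domino in the quadriculated case, a lozenge in the triangulated case). Let $N$ be the number of tilings of $R$. Each tiling corresponds to a permutation $\sigma$ of $\{1,\dots,n\}$ (the $i$-th black face and the $\sigma(i)$-th white face form a tile), hence to a nonzero monomial in the expansion of $\det B$; the tilings are split into two classes according to the sign of $\sigma$. Then, for every such labelling: 1. If $R$ is quadriculated, then $|\det B|\le 1$, and the two classes are almost balanced: the numbers of their elements differ by at most $1$. 2. If $R$ is triangulated, then $|\det B|=N$, and (at least) one of the two classes is empty. -/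

import Mathlib

/-! ### Regions made of faces of a planar cell decomposition

`F` is the type of faces of a decomposition of the plane into polygons, `V f` is the finite set of
corners of the face `f`, given by integer coordinates, and `pt` is the position in the plane `ℂ` of
a lattice point.  Everything below is used only for the two concrete decompositions
into unit squares and into unit equilateral triangles that are defined at the end. -/

namespace Tilings

/-- The graph of all faces: two different faces are adjacent iff they have a common side,
i.e. (in both decompositions of interest) iff they have exactly two corners in common. -/
def faceGraph {F : Type} (V : F → Finset (ℤ × ℤ)) : SimpleGraph F where
  Adj f g := f ≠ g ∧ (V f ∩ V g).card = 2
  symm := ⟨fun f g h => ⟨h.1.symm, by rw [Finset.inter_comm]; exact h.2⟩⟩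
  loopless := ⟨fun _ h => h.1 rfl⟩

instance {F : Type} [DecidableEq F] (V : F → Finset (ℤ × ℤ)) : DecidableRel (faceGraph V).Adj :=
  fun f g => inferInstanceAs (Decidable (f ≠ g ∧ (V f ∩ V g).card = 2))

/-- The graph `Λ` of a region: its vertices are the faces of `R`, two of them being joined iff
they have a common side. -/
def regionGraph {F : Type} (V : F → Finset (ℤ × ℤ)) (R : Finset F) : SimpleGraph R :=
  (faceGraph V).comap Subtype.val

instance {F : Type} [DecidableEq F] (V : F → Finset (ℤ × ℤ)) (R : Finset F) :
    DecidableRel (regionGraph V R).Adj :=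
  fun f g => inferInstanceAs (Decidable ((faceGraph V).Adj f.1 g.1))

/-- The region as a subset of the plane: the union of its closed faces. -/
def body {F : Type} (V : F → Finset (ℤ × ℤ)) (pt : ℤ × ℤ → ℂ) (R : Finset F) : Set ℂ :=
  ⋃ f ∈ R, convexHull ℝ (pt '' (V f : Set (ℤ × ℤ)))

/-- A tile (domino or lozenge): the union of two faces with a common side. -/
def IsTile {F : Type} [DecidableEq F] (V : F → Finset (ℤ × ℤ)) (t : Finset F) : Prop :=
  ∃ f g : F, (faceGraph V).Adj f g ∧ t = {f, g}

/-- A tiling of the region `R`: a partition of `R` into tiles. -/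
def Tiling {F : Type} [DecidableEq F] (V : F → Finset (ℤ × ℤ)) (R : Finset F) : Type :=
  {P : Finpartition R // ∀ t ∈ P.parts, IsTile V t}

/-- A labelling of the `2 * n` faces of a region with `n` black and `n` white faces
which lists the black faces first. -/
structure Labelling {F : Type} (black : F → Prop) (R : Finset F) (n : ℕ) where
  face : Fin n ⊕ Fin n ≃ R
  black_inl : ∀ i, black (face (Sum.inl i)).1
  white_inr : ∀ i, ¬ black (face (Sum.inr i)).1

/-- The adjacency matrix `A` of `Λ`, with rows and columns ordered by the labelling. -/
def Labelling.A {F : Type} [DecidableEq F] {black : F → Prop} {R : Finset F} {n : ℕ}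
    (ℓ : Labelling black R n) (V : F → Finset (ℤ × ℤ)) :
    Matrix (Fin n ⊕ Fin n) (Fin n ⊕ Fin n) ℤ :=
  ((regionGraph V R).adjMatrix ℤ).submatrix ℓ.face ℓ.face

/-- The block `B` of `A` whose rows are the black faces and whose columns are the white faces. -/
def Labelling.B {F : Type} [DecidableEq F] {black : F → Prop} {R : Finset F} {n : ℕ}
    (ℓ : Labelling black R n) (V : F → Finset (ℤ × ℤ)) : Matrix (Fin n) (Fin n) ℤ :=
  (ℓ.A V).toBlocks₁₂

/-- The tilings whose monomial in the expansion of `det B` has sign `ε`: the monomial belongs to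
the permutation `σ` for which the `i`-th black face and the `σ i`-th white face form a tile. -/
def signClass {F : Type} [DecidableEq F] {black : F → Prop} {R : Finset F} {n : ℕ}
    (V : F → Finset (ℤ × ℤ)) (ℓ : Labelling black R n) (ε : ℤˣ) : Set (Tiling V R) :=
  {T | ∃ σ : Equiv.Perm (Fin n), Equiv.Perm.sign σ = ε ∧
    ∀ i, ({(ℓ.face (Sum.inl i)).1, (ℓ.face (Sum.inr (σ i))).1} : Finset F) ∈ T.1.parts}

/-! ### The quadriculated plane -/

/-- The unit squares of the quadriculated plane, indexed by their lower left corners. -/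
abbrev Square : Type := ℤ × ℤ

/-- The corners of a unit square. -/
def squareCorners (s : Square) : Finset (ℤ × ℤ) :=
  {(s.1, s.2), (s.1 + 1, s.2), (s.1, s.2 + 1), (s.1 + 1, s.2 + 1)}

/-- The position of a point of the square lattice. -/
def squarePt (p : ℤ × ℤ) : ℂ := ⟨(p.1 : ℝ), (p.2 : ℝ)⟩

/-- The chessboard colouring. -/
def squareBlack (s : Square) : Prop := Even (s.1 + s.2)

/-! ### The triangulated plane -/

/-- The unit triangles of the triangulated plane: each unit rhombus, indexed by its
lower left corner, is cut into a triangle pointing up (`true`) and one pointing down (`false`). -/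
abbrev Triangle : Type := (ℤ × ℤ) × Bool

/-- The corners of a unit triangle. -/
def triangleCorners (t : Triangle) : Finset (ℤ × ℤ) :=
  if t.2 then {(t.1.1, t.1.2), (t.1.1 + 1, t.1.2), (t.1.1, t.1.2 + 1)}
  else {(t.1.1 + 1, t.1.2), (t.1.1, t.1.2 + 1), (t.1.1 + 1, t.1.2 + 1)}

/-- The position of a point `p` of the triangular lattice, `p.1 + p.2 * exp (i * π / 3)`. -/
noncomputable def trianglePt (p : ℤ × ℤ) : ℂ :=
  ⟨(p.1 : ℝ) + (p.2 : ℝ) / 2, (p.2 : ℝ) * (Real.sqrt 3 / 2)⟩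

/-- The colouring of the triangles: those pointing up are black. -/
def triangleBlack (t : Triangle) : Prop := t.2 = true

end Tilings

/-! The functions on oriented sides of faces that are antisymmetric and have circulation zero around
every face of `R` are gradients of functions on the lattice points: a simply connected region does
not enclose any face outside it, so such a function can be corrected outside `R` until all
circulations vanish.

For squares, an element of the kernel of `B` is, up to signs, such a function, and its potential is
characterized by equalities between its values.  Hence any function of the potential is again the
potential of an element of the kernel; if `B` is singular modulo a prime, an indicator function of
one value lifts the kernel element to a nonzero integral one, so that `det B = 0`.

For triangles, the potentials are Thurston's height functions.  Where the height difference of two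
tilings is maximal, and the height of the lower one maximal among those places, three tiles of the
latter meet; rotating them is an even permutation, and brings the two tilings closer. -/

namespace Tilings

section Logarithm

open Complex
open scoped ComplexOrder

/-- Monodromy turns paths out of a base point into a lift; as it is only needed along paths,
its continuity is not asserted. -/
theorem exists_lift_of_isCoveringMap {X Y Z : Type*} [TopologicalSpace X] [TopologicalSpace Y]
    [TopologicalSpace Z] [SimplyConnectedSpace Z] {E : X → Y} (hE : IsCoveringMap E)
    (hsurj : Function.Surjective E) (q : C(Z, Y)) :
    ∃ l : Z → X, (∀ z, E (l z) = q z) ∧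
      ∀ {z w : Z} (δ : Path z w) {y : X} (Γ : Path (l z) y),
        (∀ t, E (Γ t) = q (δ t)) → l w = y := by
  obtain ⟨z₀⟩ : Nonempty Z := inferInstance
  obtain ⟨x₀, hx₀⟩ := hsurj (q z₀)
  let γ (z : Z) : Path.Homotopic.Quotient z₀ z := .mk (PathConnectedSpace.somePath z₀ z)
  let l (z : Z) : E ⁻¹' {q z} := hE.monodromy ((γ z).map q) ⟨x₀, hx₀⟩
  have l_eq {z w : Z} (δ : Path z w) :
      l w = hE.monodromy ((Path.Homotopic.Quotient.mk δ).map q) (l z) := by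
    have hγ : γ w = (γ z).trans (.mk δ) := Subsingleton.elim _ _
    have hmap : (γ w).map q = ((γ z).map q).trans ((Path.Homotopic.Quotient.mk δ).map q) :=
      hγ ▸ congrArg Path.Homotopic.Quotient.mk (Path.map_trans _ _ q.continuous)
    simp only [l, hmap, hE.monodromy_trans_apply]
  refine ⟨fun z => l z, fun z => (l z).2, fun {z w} δ y Γ hΓ => ?_⟩
  have hy : E y = q w := by simpa using hΓ 1
  have hmono := hE.monodromy_eq_of_map_eq (γ := (Path.Homotopic.Quotient.mk δ).map q)
    (ex := l z) (ey := ⟨y, hy⟩) (.mk Γ) (congrArg Path.Homotopic.Quotient.mk (Path.ext (funext hΓ)))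
  exact congrArg Subtype.val ((l_eq δ).trans hmono)

theorem div_mem_slitPlane_of_notMem_segment {z w p : ℂ} (hp : p ∉ segment ℝ z w) :
    (w - p) / (z - p) ∈ slitPlane := by
  have hzp : z - p ≠ 0 := sub_ne_zero.2 fun h => hp (h ▸ left_mem_segment ℝ z w)
  refine mem_slitPlane_iff_not_le_zero.2 fun hle => hp (mem_segment_iff_sameRay.2 ?_)
  obtain ⟨c, hc, hcz⟩ : ∃ c : ℝ, 0 ≤ c ∧ (c : ℂ) = -((w - p) / (z - p)) :=
    RCLike.nonneg_iff_exists_ofReal.1 (neg_nonneg.2 hle)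
  have hw : w - p = c • (p - z) := by
    rw [real_smul, hcz]
    field_simp
    ring
  exact hw ▸ SameRay.sameRay_nonneg_smul_right _ hc

/-- A branch of `log (z - p)` on a simply connected set, given through its increments. -/
theorem exists_log_primitive {S : Set ℂ} (hS : IsSimplyConnected S) {p : ℂ} (hp : p ∉ S) :
    ∃ l : ℂ → ℂ, ∀ z w, segment ℝ z w ⊆ S → l w - l z = log ((w - p) / (z - p)) := by
  classical
  have := hS.simplyConnectedSpace
  have hne {z : ℂ} (hz : z ∈ S) : z - p ≠ 0 := sub_ne_zero.2 fun h => hp (h ▸ hz)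
  let q : C(S, {z : ℂ // z ≠ 0}) := ⟨fun z => ⟨z - p, hne z.2⟩, by fun_prop⟩
  obtain ⟨l, hl, hlift⟩ := exists_lift_of_isCoveringMap isCoveringMap_exp
    (fun z => ⟨log z, Subtype.ext (exp_log z.2)⟩) q
  refine ⟨fun z => if h : z ∈ S then l ⟨z, h⟩ else 0, fun z w hzw => ?_⟩
  have hz : z ∈ S := hzw (left_mem_segment ℝ z w)
  have hw : w ∈ S := hzw (right_mem_segment ℝ z w)
  let c (t : ℝ) : ℂ := z + (t : ℂ) * (w - z)
  have hcS (t : unitInterval) : c t ∈ S := hzw (by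
    rw [segment_eq_image']
    exact ⟨t, t.2, by simp [c]⟩)
  have hslit (t : unitInterval) : (c t - p) / (z - p) ∈ slitPlane := by
    refine div_mem_slitPlane_of_notMem_segment fun hpt => hp (hzw ?_)
    refine (convex_segment z w).segment_subset (left_mem_segment ℝ z w) ?_ hpt
    rw [segment_eq_image']
    exact ⟨t, t.2, by simp [c]⟩
  let δ : Path (⟨z, hz⟩ : S) ⟨w, hw⟩ :=
    { toFun t := ⟨c t, hcS t⟩
      continuous_toFun := by fun_prop
      source' := by simp [c]
      target' := by simp [c] }
  let Γ : Path (l ⟨z, hz⟩) (l ⟨z, hz⟩ + log ((w - p) / (z - p))) :=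
    { toFun t := l ⟨z, hz⟩ + log ((c t - p) / (z - p))
      continuous_toFun := continuous_const.add (Continuous.clog (by fun_prop) hslit)
      source' := by simp [c, div_self (hne hz)]
      target' := by simp [c] }
  have hΓ (t : unitInterval) : exp (Γ t) = c t - p := by
    have hlz : exp (l ⟨z, hz⟩) = z - p := congrArg Subtype.val (hl ⟨z, hz⟩)
    change exp (l ⟨z, hz⟩ + log ((c t - p) / (z - p))) = c t - p
    rw [exp_add, hlz, exp_log (slitPlane_ne_zero (hslit t)), mul_div_cancel₀ _ (hne hz)]
  simp only [hz, hw, dif_pos, hlift δ Γ fun t => Subtype.ext (hΓ t), add_sub_cancel_left]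

theorem log_div_of_re_pos {u a b : ℂ} (ha : 0 < (u * a).re) (hb : 0 < (u * b).re) :
    log (b / a) = log (u * b) - log (u * a) := by
  have hua : u * a ≠ 0 := fun h => by simp [h] at ha
  have hub : u * b ≠ 0 := fun h => by simp [h] at hb
  have hu : u ≠ 0 := left_ne_zero_of_mul hua
  have harg_a := abs_lt.1 (abs_arg_lt_pi_div_two_iff.2 (Or.inl ha))
  have harg_b := abs_lt.1 (abs_arg_lt_pi_div_two_iff.2 (Or.inl hb))
  have hπ : (u * a).arg ≠ Real.pi := by linarith [Real.pi_pos]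
  have hsum : (u * b).arg + (u * a)⁻¹.arg ∈ Set.Ioc (-Real.pi) Real.pi := by
    rw [arg_inv, if_neg hπ]
    constructor <;> linarith
  rw [← mul_div_mul_left b a hu, div_eq_mul_inv, log_mul hub (inv_ne_zero hua) hsum, log_inv _ hπ,
    sub_eq_add_neg]

end Logarithm

/-- A listing of the sides of the faces of a decomposition: the face `f` has the vertices
`corner f k` in cyclic order, its side `k` runs from `corner f k` to `corner f (next k)`, and
`across (f, k)` is the same side viewed, in the opposite direction, from the neighbouring face. -/
structure Sides {F : Type} (V : F → Finset (ℤ × ℤ)) (K : Type) where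
  corner : F → K → ℤ × ℤ
  next : Equiv.Perm K
  across : F × K → F × K
  mem_corners : ∀ f v, v ∈ V f ↔ ∃ k, corner f k = v
  across_across : ∀ x, across (across x) = x
  corner_across : ∀ x, corner (across x).1 (across x).2 = corner x.1 (next x.2)
  adj_iff : ∀ f g, (faceGraph V).Adj f g ↔ ∃ k, (across (f, k)).1 = g
  across_injective : ∀ f, Function.Injective fun k => (across (f, k)).1

/-- A region is hole-free if no nonempty finite set of faces outside it is enclosed by it. -/
def HoleFree {F : Type} (V : F → Finset (ℤ × ℤ)) (R : Finset F) : Prop :=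
  ∀ U : Finset F, Disjoint U R →
    (∀ f ∈ U, ∀ g, (faceGraph V).Adj f g → g ∈ U ∨ g ∈ R) → U = ∅

/-- The circulation around the face `f` of a function on the oriented sides `(f, k)`. -/
def curl {F K A : Type} [Fintype K] [AddCommGroup A] (c : F × K → A) (f : F) : A :=
  ∑ k, c (f, k)

theorem curl_sub {F K A : Type} [Fintype K] [AddCommGroup A] (c d : F × K → A) (f : F) :
    curl (c - d) f = curl c f - curl d f :=
  Finset.sum_sub_distrib ..

theorem curl_single {F K A : Type} [DecidableEq F] [DecidableEq K] [Fintype K] [AddCommGroup A]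
    (x : F × K) (a : A) (f : F) : curl (Pi.single x a) f = if f = x.1 then a else 0 := by
  split_ifs with h
  · rw [curl, Finset.sum_eq_single x.2] <;> aesop
  · refine Finset.sum_eq_zero fun k _ => ?_
    have hk : (f, k) ≠ x := fun hk => h (congrArg Prod.fst hk)
    exact Pi.single_eq_of_ne (M := fun _ => A) hk a

namespace Sides

variable {F K A : Type} {V : F → Finset (ℤ × ℤ)} {R U : Finset F} [AddCommGroup A] (S : Sides V K)

theorem corner_next_across (x : F × K) :
    S.corner (S.across x).1 (S.next (S.across x).2) = S.corner x.1 x.2 := by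
  rw [← S.corner_across, S.across_across]

theorem adj_across (x : F × K) : (faceGraph V).Adj x.1 (S.across x).1 :=
  (S.adj_iff _ _).2 ⟨x.2, rfl⟩

theorem across_fst_ne (x : F × K) : (S.across x).1 ≠ x.1 :=
  (S.adj_across x).ne'

theorem corner_mem (f : F) (k : K) : S.corner f k ∈ V f :=
  (S.mem_corners _ _).2 ⟨k, rfl⟩

/-- A `1`-cochain: a function on oriented sides which changes sign with the orientation. -/
def IsCochain (c : F × K → A) : Prop :=
  ∀ x, c (S.across x) = -c x

/-- The coboundary of a function on lattice points. -/
def grad (φ : ℤ × ℤ → A) (x : F × K) : A :=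
  φ (S.corner x.1 (S.next x.2)) - φ (S.corner x.1 x.2)

theorem isCochain_grad (φ : ℤ × ℤ → A) : S.IsCochain (S.grad φ) := fun x => by
  rw [grad, grad, S.corner_next_across, S.corner_across, neg_sub]

theorem curl_grad [Fintype K] (φ : ℤ × ℤ → A) (f : F) : curl (S.grad φ) f = 0 := by
  simp only [curl, grad]
  rw [Finset.sum_sub_distrib, Equiv.sum_comp S.next fun k => φ (S.corner f k), sub_self]

variable {S}

theorem IsCochain.sub {c d : F × K → A} (hc : S.IsCochain c) (hd : S.IsCochain d) :
    S.IsCochain (c - d) := fun x => by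
  simp only [Pi.sub_apply, hc x, hd x, neg_sub_neg, neg_sub]

variable (S) in
theorem isCochain_single_sub_single [DecidableEq F] [DecidableEq K] (x : F × K) (a : A) :
    S.IsCochain (Pi.single x a - Pi.single (S.across x) a : F × K → A) := by
  have hinv : Function.Involutive S.across := S.across_across
  intro y
  have hiff : S.across y = x ↔ y = S.across x := hinv.eq_iff
  have hinj : S.across y = S.across x ↔ y = x := hinv.injective.eq_iff
  simp only [Pi.sub_apply, Pi.single_apply, hiff, hinj, neg_sub]

/-- Stokes: the sides inside `U` cancel in pairs. -/
theorem IsCochain.sum_curl_eq_zero [Fintype K] {c : F × K → A} (hc : S.IsCochain c)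
    (hU : ∀ x, x.1 ∈ U → (S.across x).1 ∉ U → c x = 0) : ∑ f ∈ U, curl c f = 0 := by
  classical
  have hinner : ∑ x ∈ U ×ˢ Finset.univ with (S.across x).1 ∈ U, c x = 0 := by
    refine Finset.sum_involution (fun x _ => S.across x) (fun x _ => by rw [hc, add_neg_cancel])
      (fun x _ _ h => S.across_fst_ne x (congrArg Prod.fst h)) (fun x hx => ?_)
      (fun x _ => S.across_across x)
    simp only [Finset.mem_filter, Finset.mem_product, Finset.mem_univ, and_true] at hx ⊢
    exact ⟨hx.2, (S.across_across x).symm ▸ hx.1⟩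
  simp only [curl]
  rw [← Finset.sum_product' U Finset.univ fun f k => c (f, k), ← hinner, Finset.sum_filter_of_ne]
  intro x hx hcx
  by_contra hout
  exact hcx (hU x (Finset.mem_product.1 hx).1 hout)

end Sides

section Extension

variable {F K A : Type} {V : F → Finset (ℤ × ℤ)} {R T : Finset F} [AddCommGroup A] {S : Sides V K}

theorem HoleFree.exists_boundary_side (hR : HoleFree V R) (S : Sides V K) (hT : T.Nonempty)
    (hTR : Disjoint T R) :
    ∃ x, x.1 ∈ T ∧ (S.across x).1 ∉ T ∧ (S.across x).1 ∉ R := by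
  by_contra! h
  refine hT.ne_empty (hR T hTR fun f hf g hfg => ?_)
  obtain ⟨k, rfl⟩ := (S.adj_iff f g).1 hfg
  exact or_iff_not_imp_left.2 (h (f, k) hf)

/-- Around a face of `T` with a side leading out of `T ∪ R`, the circulation can be
corrected through that side; the other faces of `T` are treated before it. -/
theorem HoleFree.exists_closed_extension_of_disjoint [Fintype K] (hR : HoleFree V R)
    {c : F × K → A} (hc : S.IsCochain c) (hTR : Disjoint T R) :
    ∃ c' : F × K → A, S.IsCochain c' ∧ (∀ x, x.1 ∈ R → c' x = c x) ∧ ∀ f ∈ T, curl c' f = 0 := by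
  classical
  induction hn : T.card generalizing T with
  | zero => exact ⟨c, hc, fun _ _ => rfl, by simp [Finset.card_eq_zero.1 hn]⟩
  | succ n ih =>
    obtain ⟨x, hxT, hyT, hyR⟩ :=
      hR.exists_boundary_side S (Finset.card_pos.1 (hn ▸ n.succ_pos)) hTR
    obtain ⟨c', hc', hc'R, hc'T⟩ := ih (hTR.mono_left (T.erase_subset x.1))
      (by rw [Finset.card_erase_of_mem hxT, hn, Nat.add_sub_cancel])
    refine ⟨c' - (Pi.single x (curl c' x.1) - Pi.single (S.across x) (curl c' x.1)),
      hc'.sub (S.isCochain_single_sub_single x _), fun z hz => ?_, fun f hf => ?_⟩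
    · have hzx : z ≠ x := fun h => Finset.disjoint_left.1 hTR hxT (h ▸ hz)
      have hzy : z ≠ S.across x := fun h => hyR (h ▸ hz)
      simp only [Pi.sub_apply, Pi.single_apply, hzx, hzy, if_false, sub_zero, hc'R z hz]
    · have hfy : f ≠ (S.across x).1 := fun h => hyT (h ▸ hf)
      rw [curl_sub, curl_sub, curl_single, curl_single, if_neg hfy, sub_zero]
      split_ifs with hfx
      · rw [hfx, sub_self]
      · rw [hc'T f (Finset.mem_erase.2 ⟨hfx, hf⟩), sub_zero]

theorem HoleFree.exists_closed_extension [Fintype K] (hR : HoleFree V R) {c : F × K → A}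
    (hc : S.IsCochain c) (hcR : ∀ f ∈ R, curl c f = 0) (T : Finset F) :
    ∃ c' : F × K → A, S.IsCochain c' ∧ (∀ x, x.1 ∈ R → c' x = c x) ∧ ∀ f ∈ T, curl c' f = 0 := by
  classical
  obtain ⟨c', hc', hc'R, hc'T⟩ :=
    hR.exists_closed_extension_of_disjoint hc (Finset.sdiff_disjoint (s := R) (t := T))
  refine ⟨c', hc', hc'R, fun f hf => ?_⟩
  by_cases hfR : f ∈ R
  · rw [← hcR f hfR]
    exact Finset.sum_congr rfl fun k _ => hc'R (f, k) hfR
  · exact hc'T f (Finset.mem_sdiff.2 ⟨hf, hfR⟩)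

theorem HoleFree.eq_zero_outside (hR : HoleFree V R) (S : Sides V K) {φ : ℤ × ℤ → A}
    (hfin : {f | ∃ k, φ (S.corner f k) ≠ 0}.Finite)
    (hconst : ∀ f ∉ R, ∀ j k, φ (S.corner f j) = φ (S.corner f k)) {f : F} (hf : f ∉ R) (k : K) :
    φ (S.corner f k) = 0 := by
  classical
  let U : Finset F := hfin.toFinset \ R
  have hmemU {g : F} : g ∈ U ↔ (∃ k, φ (S.corner g k) ≠ 0) ∧ g ∉ R := by
    simp only [U, Finset.mem_sdiff, Set.Finite.mem_toFinset, Set.mem_ofPred_eq]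
  have hU : U = ∅ := by
    refine hR U Finset.sdiff_disjoint fun f hf g hfg => or_iff_not_imp_right.2 fun hg => ?_
    obtain ⟨⟨j, hj⟩, hfR⟩ := hmemU.1 hf
    obtain ⟨k, rfl⟩ := (S.adj_iff f g).1 hfg
    refine hmemU.2 ⟨⟨(S.across (f, k)).2, ?_⟩, hg⟩
    rwa [S.corner_across, hconst f hfR _ j]
  by_contra h
  exact Finset.notMem_empty f (hU ▸ hmemU.2 ⟨⟨k, h⟩, hf⟩)

end Extension

section Winding

open Complex

variable {F K : Type} {V : F → Finset (ℤ × ℤ)} {R : Finset F} {S : Sides V K} {pt : ℤ × ℤ → ℂ}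
  {f₀ : F} {p r : ℂ}

/-- The point `p` is fixed by a rotation of the face `f₀`, with multiplier `r`, and is
separated by a line from every other face. -/
structure Sides.IsRotationCentre (S : Sides V K) (pt : ℤ × ℤ → ℂ) (f₀ : F) (p r : ℂ) : Prop where
  ne_zero : r ≠ 0
  ne_one : r ≠ 1
  rotate : ∀ k, pt (S.corner f₀ (S.next k)) - p = r * (pt (S.corner f₀ k) - p)
  halfPlane : ∀ f ≠ f₀, ∃ u : ℂ, ∀ k, 0 < (u * (pt (S.corner f k) - p)).re

theorem notMem_convexHull_of_re_pos {s : Set ℂ} {u p : ℂ} (hs : ∀ z ∈ s, 0 < (u * (z - p)).re) :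
    p ∉ convexHull ℝ s := by
  have hlin : IsLinearMap ℝ fun z : ℂ => (u * z).re :=
    (reCLM.toLinearMap.comp (LinearMap.mulLeft ℝ u)).isLinear
  intro hp
  have hmem := convexHull_min (fun z hz => ?_) (convex_halfSpace_gt hlin (u * p).re) hp
  · exact lt_irrefl (u * p).re hmem
  · simpa only [Set.mem_ofPred_eq, mul_sub, sub_re, sub_pos] using hs z hz

/-- The increment of `log (z - p)` along a side, taken in its principal value. -/
noncomputable def Sides.logStep (S : Sides V K) (pt : ℤ × ℤ → ℂ) (p : ℂ) (x : F × K) : ℂ :=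
  log ((pt (S.corner x.1 (S.next x.2)) - p) / (pt (S.corner x.1 x.2) - p))

namespace Sides.IsRotationCentre

theorem notMem_body (hp : S.IsRotationCentre pt f₀ p r) (hf₀ : f₀ ∉ R) : p ∉ body V pt R := by
  simp only [body, Set.mem_iUnion, not_exists]
  intro f hf
  obtain ⟨u, hu⟩ := hp.halfPlane f fun h => hf₀ (h ▸ hf)
  refine notMem_convexHull_of_re_pos (u := u) ?_
  rintro _ ⟨v, hv, rfl⟩
  obtain ⟨k, rfl⟩ := (S.mem_corners f v).1 hv
  exact hu k

theorem exists_log_div_eq_sub (hp : S.IsRotationCentre pt f₀ p r) {f : F} (hf : f ≠ f₀) :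
    ∃ φ : ℤ × ℤ → ℂ, ∀ j k, log ((pt (S.corner f k) - p) / (pt (S.corner f j) - p)) =
      φ (S.corner f k) - φ (S.corner f j) := by
  obtain ⟨u, hu⟩ := hp.halfPlane f hf
  exact ⟨fun v => log (u * (pt v - p)), fun j k => log_div_of_re_pos (hu j) (hu k)⟩

theorem isCochain_logStep (hp : S.IsRotationCentre pt f₀ p r) : S.IsCochain (S.logStep pt p) := by
  have key (x : F × K) (hx : x.1 ≠ f₀) : S.logStep pt p (S.across x) = -S.logStep pt p x := by
    obtain ⟨φ, hφ⟩ := hp.exists_log_div_eq_sub hx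
    simp only [logStep, S.corner_across, S.corner_next_across, hφ, neg_sub]
  intro x
  by_cases hx : x.1 = f₀
  · have h := key (S.across x) (hx ▸ S.across_fst_ne x)
    rw [S.across_across] at h
    rw [h, neg_neg]
  · exact key x hx

variable [Fintype K]

theorem curl_logStep_of_ne (hp : S.IsRotationCentre pt f₀ p r) {f : F} (hf : f ≠ f₀) :
    curl (S.logStep pt p) f = 0 := by
  obtain ⟨φ, hφ⟩ := hp.exists_log_div_eq_sub hf
  rw [← S.curl_grad φ f]
  exact Finset.sum_congr rfl fun k _ => hφ k (S.next k)

theorem curl_logStep_self (hp : S.IsRotationCentre pt f₀ p r) :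
    curl (S.logStep pt p) f₀ = Fintype.card K * log r := by
  have hstep (k : K) : S.logStep pt p (f₀, k) = log r := by
    have hk : pt (S.corner f₀ k) - p ≠ 0 := fun h => by
      obtain ⟨u, hu⟩ := hp.halfPlane _ (S.across_fst_ne (f₀, k))
      have hpos := hu (S.next (S.across (f₀, k)).2)
      simp [S.corner_next_across, h] at hpos
    rw [logStep, hp.rotate, mul_div_cancel_right₀ _ hk]
  simp only [curl, hstep, Finset.sum_const, Finset.card_univ, nsmul_eq_mul]

end Sides.IsRotationCentre

/-- If `U ∋ f₀` were enclosed by `R`, then, `log (z - p)` having a branch on the body of `R`, its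
increments would sum to zero along the boundary of `U`, which winds around the centre `p` of `f₀`.
-/
theorem holeFree_of_isSimplyConnected [Finite K] [Nonempty K] (S : Sides V K)
    (hcentre : ∀ f₀, ∃ p r, S.IsRotationCentre pt f₀ p r)
    (hR : IsSimplyConnected (body V pt R)) : HoleFree V R := by
  intro U hUR hU
  cases nonempty_fintype K
  by_contra hne
  obtain ⟨f₀, hf₀⟩ := Finset.nonempty_iff_ne_empty.2 hne
  obtain ⟨p, r, hp⟩ := hcentre f₀
  obtain ⟨l, hl⟩ := exists_log_primitive hR (hp.notMem_body (Finset.disjoint_left.1 hUR hf₀))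
  let D : F × K → ℂ := S.logStep pt p - S.grad fun v => l (pt v)
  have hD : S.IsCochain D := hp.isCochain_logStep.sub (S.isCochain_grad _)
  have hDR (x : F × K) (hx : x.1 ∈ R) : D x = 0 := by
    refine sub_eq_zero.2 (hl _ _ ?_).symm
    have hmem (k : K) : pt (S.corner x.1 k) ∈ convexHull ℝ (pt '' (V x.1 : Set (ℤ × ℤ))) :=
      subset_convexHull ℝ _ ⟨_, S.corner_mem x.1 k, rfl⟩
    exact ((convex_convexHull ℝ _).segment_subset (hmem _) (hmem _)).trans
      (Set.subset_biUnion_of_mem (u := fun f => convexHull ℝ (pt '' (V f : Set (ℤ × ℤ)))) hx)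
  have hsum : ∑ f ∈ U, curl D f = 0 := hD.sum_curl_eq_zero fun x hx hxU => by
    have hxR := (hU x.1 hx _ (S.adj_across x)).resolve_left hxU
    rw [← neg_eq_zero, ← hD x, hDR _ hxR]
  have hcurl (f : F) : curl D f = curl (S.logStep pt p) f := by
    rw [curl_sub, S.curl_grad, sub_zero]
  have hlog : Fintype.card K * log r = 0 := by
    rw [← hp.curl_logStep_self, ← hsum, Finset.sum_eq_single_of_mem f₀ hf₀, hcurl]
    intro f _ hf
    rw [hcurl, hp.curl_logStep_of_ne hf]
  have hr : log r = 0 := (mul_eq_zero.1 hlog).resolve_left (by simp)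
  exact hp.ne_one (by rw [← exp_log hp.ne_zero, hr, exp_zero])

end Winding

theorem faceGraph_adj_of_common_corners {F : Type} {V : F → Finset (ℤ × ℤ)} {f g : F}
    {v w : ℤ × ℤ} (hfg : f ≠ g) (hvw : v ≠ w) (h : ∀ u, u ∈ V f ∧ u ∈ V g ↔ u = v ∨ u = w) :
    (faceGraph V).Adj f g :=
  ⟨hfg, Finset.card_eq_two.2 ⟨v, w, hvw, by ext u; simpa using h u⟩⟩

section Square

theorem square_adj_iff {f g : Square} : (faceGraph squareCorners).Adj f g ↔
    g = (f.1, f.2 - 1) ∨ g = (f.1 + 1, f.2) ∨ g = (f.1, f.2 + 1) ∨ g = (f.1 - 1, f.2) := by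
  obtain ⟨a, b⟩ := f
  constructor
  · rintro ⟨hne, hcard⟩
    obtain ⟨v, hv, w, hw, hvw⟩ := Finset.one_lt_card.1 (hcard ▸ one_lt_two)
    simp only [squareCorners, Finset.mem_inter, Finset.mem_insert, Finset.mem_singleton,
      Prod.ext_iff, ne_eq] at *
    omega
  · have key (v w : ℤ × ℤ) := faceGraph_adj_of_common_corners (V := squareCorners) (f := (a, b))
      (g := g) (v := v) (w := w)
    rintro (rfl | rfl | rfl | rfl)
    · exact key (a, b) (a + 1, b) (by simp; omega) (by simp) fun u => by
        simp [squareCorners, Prod.ext_iff]; omega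
    · exact key (a + 1, b) (a + 1, b + 1) (by simp) (by simp) fun u => by
        simp [squareCorners, Prod.ext_iff]; omega
    · exact key (a, b + 1) (a + 1, b + 1) (by simp) (by simp) fun u => by
        simp [squareCorners, Prod.ext_iff]; omega
    · exact key (a, b) (a, b + 1) (by simp; omega) (by simp) fun u => by
        simp [squareCorners, Prod.ext_iff]; omega

/-- The sides of a unit square, counterclockwise from the bottom one. -/
def squareSides : Sides squareCorners (Fin 4) where
  corner f := ![f, (f.1 + 1, f.2), (f.1 + 1, f.2 + 1), (f.1, f.2 + 1)]
  next := finRotate 4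
  across x :=
    (![(x.1.1, x.1.2 - 1), (x.1.1 + 1, x.1.2), (x.1.1, x.1.2 + 1), (x.1.1 - 1, x.1.2)] x.2,
      ![2, 3, 0, 1] x.2)
  mem_corners f v := by
    simp [squareCorners, Fin.exists_fin_succ, eq_comm]
    tauto
  across_across := by
    rintro ⟨f, k⟩
    fin_cases k <;> simp
  corner_across := by
    rintro ⟨f, k⟩
    fin_cases k <;> simp
  adj_iff f g := by simp [square_adj_iff, Fin.exists_fin_succ, eq_comm]
  across_injective f j k := by
    fin_cases j <;> fin_cases k <;> simp <;> omega

theorem square_exists_rotationCentre (f₀ : Square) :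
    ∃ p r, squareSides.IsRotationCentre squarePt f₀ p r := by
  refine ⟨⟨f₀.1 + 1 / 2, f₀.2 + 1 / 2⟩, Complex.I, Complex.I_ne_zero, ?_, fun k => ?_, ?_⟩
  · exact fun h => by simpa using congrArg Complex.re h
  · fin_cases k <;> apply Complex.ext <;> simp [squarePt, squareSides] <;> ring
  · rintro f hne
    have hsep : f₀.1 + 1 ≤ f.1 ∨ f.1 + 1 ≤ f₀.1 ∨ f₀.2 + 1 ≤ f.2 ∨ f.2 + 1 ≤ f₀.2 := by
      by_contra hcon
      exact hne (Prod.ext (by omega) (by omega))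
    rcases hsep with h | h | h | h <;> rify at h
    · refine ⟨1, fun k => ?_⟩
      fin_cases k <;> simp [squarePt, squareSides] <;> linarith
    · refine ⟨-1, fun k => ?_⟩
      fin_cases k <;> simp [squarePt, squareSides] <;> linarith
    · refine ⟨-Complex.I, fun k => ?_⟩
      fin_cases k <;> simp [squarePt, squareSides] <;> linarith
    · refine ⟨Complex.I, fun k => ?_⟩
      fin_cases k <;> simp [squarePt, squareSides] <;> linarith

theorem square_holeFree {R : Finset Square}
    (hR : IsSimplyConnected (body squareCorners squarePt R)) :
    HoleFree squareCorners R :=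
  holeFree_of_isSimplyConnected squareSides square_exists_rotationCentre hR

end Square

section Triangle

theorem triangle_adj_iff {f g : Triangle} : (faceGraph triangleCorners).Adj f g ↔
    f.2 = true ∧ (g = ((f.1.1, f.1.2 - 1), false) ∨ g = (f.1, false) ∨
      g = ((f.1.1 - 1, f.1.2), false)) ∨
    f.2 = false ∧ (g = ((f.1.1, f.1.2 + 1), true) ∨ g = (f.1, true) ∨
      g = ((f.1.1 + 1, f.1.2), true)) := by
  obtain ⟨⟨a, b⟩, c⟩ := f
  constructor
  · obtain ⟨⟨x, y⟩, d⟩ := g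
    rintro ⟨hne, hcard⟩
    obtain ⟨v, hv, w, hw, hvw⟩ := Finset.one_lt_card.1 (hcard ▸ one_lt_two)
    cases c <;> cases d <;>
      simp [triangleCorners, Prod.ext_iff] at * <;> omega
  · have key (v w : ℤ × ℤ) := faceGraph_adj_of_common_corners (V := triangleCorners)
      (f := ((a, b), c)) (g := g) (v := v) (w := w)
    rintro (⟨rfl : c = true, rfl | rfl | rfl⟩ | ⟨rfl : c = false, rfl | rfl | rfl⟩)
    · exact key (a, b) (a + 1, b) (by simp) (by simp) fun u => by
        simp [triangleCorners, Prod.ext_iff]; omega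
    · exact key (a + 1, b) (a, b + 1) (by simp) (by simp) fun u => by
        simp [triangleCorners, Prod.ext_iff]; omega
    · exact key (a, b) (a, b + 1) (by simp) (by simp) fun u => by
        simp [triangleCorners, Prod.ext_iff]; omega
    · exact key (a, b + 1) (a + 1, b + 1) (by simp) (by simp) fun u => by
        simp [triangleCorners, Prod.ext_iff]; omega
    · exact key (a + 1, b) (a, b + 1) (by simp) (by simp) fun u => by
        simp [triangleCorners, Prod.ext_iff]; omega
    · exact key (a + 1, b) (a + 1, b + 1) (by simp) (by simp) fun u => by
        simp [triangleCorners, Prod.ext_iff]; omega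

/-- The sides of a unit triangle, counterclockwise from the horizontal one; a side has the same
index in both of its triangles. -/
def triangleSides : Sides triangleCorners (Fin 3) where
  corner f := if f.2 then ![f.1, (f.1.1 + 1, f.1.2), (f.1.1, f.1.2 + 1)]
    else ![(f.1.1 + 1, f.1.2 + 1), (f.1.1, f.1.2 + 1), (f.1.1 + 1, f.1.2)]
  next := finRotate 3
  across x := (if x.1.2 then (![(x.1.1.1, x.1.1.2 - 1), x.1.1, (x.1.1.1 - 1, x.1.1.2)] x.2, false)
    else (![(x.1.1.1, x.1.1.2 + 1), x.1.1, (x.1.1.1 + 1, x.1.1.2)] x.2, true), x.2)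
  mem_corners := by
    rintro ⟨f, _ | _⟩ v <;> simp [triangleCorners, Fin.exists_fin_succ, eq_comm]
    tauto
  across_across := by
    rintro ⟨⟨f, _ | _⟩, k⟩ <;> fin_cases k <;> simp
  corner_across := by
    rintro ⟨⟨f, _ | _⟩, k⟩ <;> fin_cases k <;> simp
  adj_iff := by
    rintro ⟨f, _ | _⟩ g <;> simp [triangle_adj_iff, Fin.exists_fin_succ, eq_comm]
  across_injective := by
    rintro ⟨f, _ | _⟩ j k <;> fin_cases j <;> fin_cases k <;> simp [Prod.ext_iff] <;> omega

/-- The centroid of a unit triangle. -/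
noncomputable def triangleCentre (f : Triangle) : ℂ :=
  trianglePt f.1 + (if f.2 then 1 else 2) * ⟨1 / 2, Real.sqrt 3 / 6⟩

/-- In thirds of a lattice step, `(c, c)` are the coordinates of the centroid of `f₀` relative to
`f₀.1`; the separating lines are parallel to the sides. -/
theorem triangle_exists_separation {f₀ f : Triangle} (hne : f ≠ f₀) :
    ∃ i j : ℤ, ∀ k, 0 < i * (3 * ((triangleSides.corner f k).1 - f₀.1.1) - if f₀.2 then 1 else 2) +
      j * (3 * ((triangleSides.corner f k).2 - f₀.1.2) - if f₀.2 then 1 else 2) := by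
  obtain ⟨⟨a, b⟩, c⟩ := f₀
  obtain ⟨⟨x, y⟩, d⟩ := f
  cases c
  · rcases lt_or_ge a x with h | hx
    · refine ⟨1, 0, fun k => ?_⟩
      cases d <;> fin_cases k <;> simp [triangleSides] <;> omega
    rcases lt_or_ge b y with h | hy
    · refine ⟨0, 1, fun k => ?_⟩
      cases d <;> fin_cases k <;> simp [triangleSides] <;> omega
    refine ⟨-1, -1, fun k => ?_⟩
    cases d <;> fin_cases k <;> simp [triangleSides] at hne ⊢ <;> omega
  · rcases lt_or_ge x a with h | hx
    · refine ⟨-1, 0, fun k => ?_⟩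
      cases d <;> fin_cases k <;> simp [triangleSides] <;> omega
    rcases lt_or_ge y b with h | hy
    · refine ⟨0, -1, fun k => ?_⟩
      cases d <;> fin_cases k <;> simp [triangleSides] <;> omega
    refine ⟨1, 1, fun k => ?_⟩
    cases d <;> fin_cases k <;> simp [triangleSides] at hne ⊢ <;> omega

theorem re_mul_trianglePt_sub_triangleCentre (f₀ : Triangle) (i j : ℤ) (v : ℤ × ℤ) :
    ((i * ⟨3, Real.sqrt 3⟩ - j * ⟨0, 2 * Real.sqrt 3⟩) * (trianglePt v - triangleCentre f₀)).re =
      i * (3 * (v.1 - f₀.1.1) - if f₀.2 then 1 else 2) +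
        j * (3 * (v.2 - f₀.1.2) - if f₀.2 then 1 else 2) := by
  have h3 : Real.sqrt 3 ^ 2 = 3 := Real.sq_sqrt (by norm_num)
  obtain ⟨⟨a, b⟩, _ | _⟩ := f₀ <;>
    simp [trianglePt, triangleCentre] <;> ring_nf <;> rw [h3] <;> ring

theorem triangle_exists_rotationCentre (f₀ : Triangle) :
    ∃ p r, triangleSides.IsRotationCentre trianglePt f₀ p r := by
  have h3 : Real.sqrt 3 ^ 2 = 3 := Real.sq_sqrt (by norm_num)
  refine ⟨triangleCentre f₀, ⟨-1 / 2, Real.sqrt 3 / 2⟩, ?_, ?_, fun k => ?_, fun f hne => ?_⟩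
  · exact fun h => by simpa using congrArg Complex.re h
  · exact fun h => by have := congrArg Complex.re h; norm_num at this
  · obtain ⟨f, _ | _⟩ := f₀ <;> fin_cases k <;> apply Complex.ext <;>
      simp [trianglePt, triangleCentre, triangleSides] <;> linarith
  · obtain ⟨i, j, hij⟩ := triangle_exists_separation hne
    refine ⟨i * ⟨3, Real.sqrt 3⟩ - j * ⟨0, 2 * Real.sqrt 3⟩, fun k => ?_⟩
    rw [re_mul_trianglePt_sub_triangleCentre]
    exact_mod_cast hij k

theorem triangle_holeFree {R : Finset Triangle}
    (hR : IsSimplyConnected (body triangleCorners trianglePt R)) : HoleFree triangleCorners R :=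
  holeFree_of_isSimplyConnected triangleSides triangle_exists_rotationCentre hR

end Triangle

section SquarePotential

variable {A : Type} [AddCommGroup A] {c : Square × Fin 4 → A} {a b : ℤ × ℤ}

theorem squareSides_grad (φ : ℤ × ℤ → A) (f : Square) (k : Fin 4) :
    squareSides.grad φ (f, k) = ![φ (f.1 + 1, f.2) - φ f, φ (f.1 + 1, f.2 + 1) - φ (f.1 + 1, f.2),
      φ (f.1, f.2 + 1) - φ (f.1 + 1, f.2 + 1), φ f - φ (f.1, f.2 + 1)] k := by
  fin_cases k <;> rfl

theorem square_isCochain_iff : squareSides.IsCochain c ↔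
    ∀ f, c (f, 2) = -c ((f.1, f.2 + 1), 0) ∧ c (f, 1) = -c ((f.1 + 1, f.2), 3) := by
  constructor
  · exact fun hc f => ⟨by rw [← hc]; simp [squareSides], by rw [← hc]; simp [squareSides]⟩
  · rintro h ⟨f, k⟩
    fin_cases k <;> simp [squareSides, h]

theorem square_grad_eq_of_pairs {φ : ℤ × ℤ → A} {f : Square} (hc : squareSides.IsCochain c)
    (hbottom : φ (f.1 + 1, f.2) - φ f = c (f, 0))
    (htop : φ (f.1 + 1, f.2 + 1) - φ (f.1, f.2 + 1) = c ((f.1, f.2 + 1), 0))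
    (hleft : φ (f.1, f.2 + 1) - φ f = -c (f, 3))
    (hright : φ (f.1 + 1, f.2 + 1) - φ (f.1 + 1, f.2) = -c ((f.1 + 1, f.2), 3)) (k : Fin 4) :
    squareSides.grad φ (f, k) = c (f, k) := by
  obtain ⟨h2, h1⟩ := square_isCochain_iff.1 hc f
  rw [squareSides_grad]
  fin_cases k
  · exact hbottom
  · exact hright.trans h1.symm
  · exact (neg_sub _ _).symm.trans ((congrArg _ htop).trans h2.symm)
  · exact (neg_sub _ _).symm.trans ((congrArg _ hleft).trans (neg_neg _))

/-- The function on lattice points which is `p` on the line of height `y₀` and is integrated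
upwards from there along the left sides of squares, so as to have the coboundary `c`. -/
noncomputable def columnPotential (p : ℤ → A) (c : Square × Fin 4 → A) (y₀ : ℤ) (v : ℤ × ℤ) : A :=
  p v.1 - ∑ t ∈ Finset.Ico y₀ v.2, c ((v.1, t), 3)

theorem columnPotential_of_le (p : ℤ → A) {x y₀ y : ℤ} (hy : y ≤ y₀) :
    columnPotential p c y₀ (x, y) = p x := by
  rw [columnPotential, Finset.Ico_eq_empty (not_lt.2 hy), Finset.sum_empty, sub_zero]

theorem columnPotential_succ (p : ℤ → A) {x y₀ y : ℤ} (hy : y₀ ≤ y) :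
    columnPotential p c y₀ (x, y + 1) = columnPotential p c y₀ (x, y) - c ((x, y), 3) := by
  simp only [columnPotential]
  rw [← Finset.sum_Ico_add_eq_sum_Ico_add_one hy, sub_add_eq_sub_sub]

theorem columnPotential_horizontal {p : ℤ → A} {x y₀ y : ℤ} (hc : squareSides.IsCochain c)
    (hp : p (x + 1) - p x = c ((x, y₀), 0)) (hy : y₀ ≤ y)
    (hcurl : ∀ t ∈ Finset.Ico y₀ y, curl c (x, t) = 0) :
    columnPotential p c y₀ (x + 1, y) - columnPotential p c y₀ (x, y) = c ((x, y), 0) := by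
  induction y, hy using Int.leInduction with
  | base => rw [columnPotential_of_le p le_rfl, columnPotential_of_le p le_rfl, hp]
  | succ y hy ih =>
    obtain ⟨h2, h1⟩ := square_isCochain_iff.1 hc (x, y)
    have hxy : curl c (x, y) = 0 := hcurl y (Finset.mem_Ico.2 ⟨hy, y.lt_succ⟩)
    specialize ih fun t ht => hcurl t (Finset.Ico_subset_Ico_right y.lt_succ.le ht)
    rw [curl, Fin.sum_univ_four, h2, h1, ← ih] at hxy
    rw [columnPotential_succ p hy, columnPotential_succ p hy, ← sub_eq_zero, ← hxy]
    abel

theorem columnPotential_grad {p : ℤ → A} {y₀ : ℤ} {f : Square} (hc : squareSides.IsCochain c)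
    (hp : p (f.1 + 1) - p f.1 = c ((f.1, y₀), 0)) (hy : y₀ ≤ f.2)
    (hcurl : ∀ t ∈ Finset.Icc y₀ f.2, curl c (f.1, t) = 0) (k : Fin 4) :
    squareSides.grad (columnPotential p c y₀) (f, k) = c (f, k) := by
  refine square_grad_eq_of_pairs hc ?_ ?_ ?_ ?_ k
  · exact columnPotential_horizontal hc hp hy fun t ht =>
      hcurl t (Finset.Ico_subset_Icc_self ht)
  · refine columnPotential_horizontal hc hp (hy.trans f.2.lt_succ.le) fun t ht => hcurl t ?_
    simpa [Int.lt_add_one_iff] using ht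
  · rw [columnPotential_succ p hy, sub_sub_cancel_left]
  · rw [columnPotential_succ p hy, sub_sub_cancel_left]

theorem square_exists_potential_of_box (hc : squareSides.IsCochain c)
    (hbox : ∀ f ∈ Finset.Icc a b, curl c f = 0) :
    ∃ φ : ℤ × ℤ → A, ∀ f ∈ Finset.Icc a b, ∀ k, squareSides.grad φ (f, k) = c (f, k) := by
  refine ⟨columnPotential (fun x => ∑ s ∈ Finset.Ico a.1 x, c ((s, a.2), 0)) c a.2,
    fun f hf k => ?_⟩
  obtain ⟨⟨ha₁, ha₂⟩, hb₁, hb₂⟩ := Finset.mem_Icc.1 hf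
  refine columnPotential_grad hc ?_ ha₂ (fun t ht => hbox _ (Finset.mem_Icc.2 ?_)) k
  · rw [← Finset.sum_Ico_add_eq_sum_Ico_add_one ha₁, add_sub_cancel_left]
  · obtain ⟨h₁, h₂⟩ := Finset.mem_Icc.1 ht
    exact ⟨⟨ha₁, h₁⟩, hb₁, h₂.trans hb₂⟩

theorem square_exists_potential_of_finite_support (hc : squareSides.IsCochain c)
    (hcurl : ∀ f, curl c f = 0) (hsupp : ∀ f ∉ Finset.Icc a b, ∀ k, c (f, k) = 0) :
    ∃ φ : ℤ × ℤ → A, squareSides.grad φ = c ∧ ∀ v ∉ Finset.Icc a b, φ v = 0 := by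
  set φ : ℤ × ℤ → A := columnPotential 0 c a.2 with hφ
  have hbelow {x y : ℤ} (hy : y ≤ a.2) : φ (x, y) = 0 := columnPotential_of_le 0 hy
  have hout {x y : ℤ} (h : ¬(a.1 ≤ x ∧ a.2 ≤ y ∧ x ≤ b.1 ∧ y ≤ b.2)) (k : Fin 4) :
      c ((x, y), k) = 0 :=
    hsupp _ (fun hf => h (by simpa [Prod.le_def, and_assoc] using hf)) k
  have hgrad (f : Square) (k : Fin 4) : squareSides.grad φ (f, k) = c (f, k) := by
    obtain ⟨x, y⟩ := f
    rcases lt_or_ge y a.2 with hy | hy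
    · rw [hout (by omega), squareSides_grad]
      fin_cases k <;> simp [hbelow hy.le, hbelow (Int.add_one_le_iff.2 hy)]
    · refine columnPotential_grad hc ?_ hy (fun t _ => hcurl (x, t)) k
      have h2 := (square_isCochain_iff.1 hc (x, a.2 - 1)).1
      rw [hout (by omega), sub_add_cancel, zero_eq_neg] at h2
      rw [h2]
      exact sub_self 0
  refine ⟨φ, funext fun x => hgrad x.1 x.2, fun v hv => ?_⟩
  obtain ⟨x, y⟩ := v
  replace hv : ¬(a.1 ≤ x ∧ a.2 ≤ y ∧ x ≤ b.1 ∧ y ≤ b.2) := fun h =>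
    hv (by simpa [Prod.le_def, and_assoc] using h)
  have hside {x : ℤ} (hx : ¬(a.1 ≤ x ∧ x ≤ b.1)) : φ (x, y) = 0 := by
    rw [hφ, columnPotential, Finset.sum_eq_zero fun t _ => hout (by omega) 3]
    exact sub_self 0
  by_cases hx : a.1 ≤ x ∧ x ≤ b.1
  · rcases lt_or_ge y a.2 with hy | hy
    · exact hbelow hy.le
    · have hper : Function.Periodic (fun x => φ (x, y)) 1 := fun x => by
        have h := hgrad (x, y) 0
        rwa [hout (by omega), squareSides_grad, Matrix.cons_val_zero, sub_eq_zero] at h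
      have h := hper.sub_zsmul_eq (x := x) (x - (a.1 - 1))
      simp only [smul_eq_mul, mul_one, sub_sub_cancel] at h
      rw [← h]
      exact hside (by omega)
  · exact hside hx

end SquarePotential

section TrianglePotential

variable {A : Type} [AddCommGroup A] {c : Triangle × Fin 3 → A}

theorem triangle_isCochain_iff : triangleSides.IsCochain c ↔
    ∀ p : ℤ × ℤ, c ((p, false), 0) = -c (((p.1, p.2 + 1), true), 0) ∧
      c ((p, false), 1) = -c ((p, true), 1) ∧
      c ((p, false), 2) = -c (((p.1 + 1, p.2), true), 2) := by
  constructor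
  · exact fun hc p => ⟨by rw [← hc]; simp [triangleSides], by rw [← hc]; simp [triangleSides],
      by rw [← hc]; simp [triangleSides]⟩
  · rintro h ⟨⟨p, _ | _⟩, k⟩ <;> fin_cases k <;> simp [triangleSides, h]

/-- The restriction of a cochain to the sides of the rhombi `{(p, true), (p, false)}`, which
are the squares of the lattice `ℤ × ℤ`. -/
def rhombusCochain (c : Triangle × Fin 3 → A) (x : Square × Fin 4) : A :=
  ![c ((x.1, true), 0), c ((x.1, false), 2), c ((x.1, false), 0), c ((x.1, true), 2)] x.2

theorem isCochain_rhombusCochain (hc : triangleSides.IsCochain c) :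
    squareSides.IsCochain (rhombusCochain c) :=
  square_isCochain_iff.2 fun p =>
    ⟨(triangle_isCochain_iff.1 hc p).1, (triangle_isCochain_iff.1 hc p).2.2⟩

theorem curl_rhombusCochain (hc : triangleSides.IsCochain c) (p : ℤ × ℤ) :
    curl (rhombusCochain c) p = curl c (p, true) + curl c (p, false) := by
  simp only [curl, Fin.sum_univ_three, Fin.sum_univ_four, rhombusCochain, Matrix.cons_val,
    (triangle_isCochain_iff.1 hc p).2.1]
  abel

/-- On the diagonal of the rhombus both circulations vanish, hence the remaining side. -/
theorem triangle_grad_eq_of_rhombus {φ : ℤ × ℤ → A} {f : Triangle} (hf : curl c f = 0)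
    (hφ : ∀ k, squareSides.grad φ (f.1, k) = rhombusCochain c (f.1, k)) (k : Fin 3) :
    triangleSides.grad φ (f, k) = c (f, k) := by
  have h0 : triangleSides.grad φ (f, 0) = c (f, 0) := by
    obtain ⟨p, _ | _⟩ := f
    exacts [hφ 2, hφ 0]
  have h2 : triangleSides.grad φ (f, 2) = c (f, 2) := by
    obtain ⟨p, _ | _⟩ := f
    exacts [hφ 1, hφ 3]
  have hcurl := (triangleSides.curl_grad φ f).trans hf.symm
  rw [curl, curl, Fin.sum_univ_three, Fin.sum_univ_three, h0, h2, add_left_inj,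
    add_right_inj] at hcurl
  fin_cases k
  exacts [h0, hcurl, h2]

end TrianglePotential

section Potential

variable {A : Type} [AddCommGroup A]

theorem square_exists_potential {R : Finset Square} {c : Square × Fin 4 → A}
    (hR : HoleFree squareCorners R) (hc : squareSides.IsCochain c)
    (hcR : ∀ f ∈ R, curl c f = 0) :
    ∃ φ : ℤ × ℤ → A, ∀ f ∈ R, ∀ k, squareSides.grad φ (f, k) = c (f, k) := by
  obtain ⟨a, ha⟩ := R.bddBelow
  obtain ⟨b, hb⟩ := R.bddAbove
  obtain ⟨c', hc', hc'R, hc'box⟩ := hR.exists_closed_extension hc hcR (Finset.Icc a b)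
  obtain ⟨φ, hφ⟩ := square_exists_potential_of_box hc' hc'box
  exact ⟨φ, fun f hf k =>
    (hφ f (Finset.mem_Icc.2 ⟨ha hf, hb hf⟩) k).trans (hc'R (f, k) hf)⟩

theorem triangle_exists_potential {R : Finset Triangle} {c : Triangle × Fin 3 → A}
    (hR : HoleFree triangleCorners R) (hc : triangleSides.IsCochain c)
    (hcR : ∀ f ∈ R, curl c f = 0) :
    ∃ φ : ℤ × ℤ → A, ∀ f ∈ R, ∀ k, triangleSides.grad φ (f, k) = c (f, k) := by
  obtain ⟨a, ha⟩ := (R.image Prod.fst).bddBelow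
  obtain ⟨b, hb⟩ := (R.image Prod.fst).bddAbove
  obtain ⟨c', hc', hc'R, hc'box⟩ :=
    hR.exists_closed_extension hc hcR (Finset.Icc a b ×ˢ Finset.univ)
  replace hc'box {p : ℤ × ℤ} (hp : p ∈ Finset.Icc a b) (d : Bool) : curl c' (p, d) = 0 :=
    hc'box _ (Finset.mem_product.2 ⟨hp, Finset.mem_univ d⟩)
  obtain ⟨φ, hφ⟩ := square_exists_potential_of_box (isCochain_rhombusCochain hc')
    fun p hp => by rw [curl_rhombusCochain hc', hc'box hp, hc'box hp, add_zero]
  refine ⟨φ, fun f hf k => ?_⟩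
  have hp : f.1 ∈ Finset.Icc a b := by
    have hfst := Finset.mem_image_of_mem Prod.fst hf
    exact Finset.mem_Icc.2 ⟨ha hfst, hb hfst⟩
  rw [triangle_grad_eq_of_rhombus (hc'box hp f.2) (hφ f.1 hp), hc'R (f, k) hf]

theorem triangle_exists_interior_potential {R : Finset Triangle} {c : Triangle × Fin 3 → A}
    (hR : HoleFree triangleCorners R) (hc : triangleSides.IsCochain c)
    (hcurl : ∀ f, curl c f = 0) (hsupp : ∀ f ∉ R, ∀ k, c (f, k) = 0) :
    ∃ φ : ℤ × ℤ → A, triangleSides.grad φ = c ∧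
      ∀ f ∉ R, ∀ k, φ (triangleSides.corner f k) = 0 := by
  obtain ⟨a, ha⟩ := (R.image Prod.fst).bddBelow
  obtain ⟨b, hb⟩ := (R.image Prod.fst).bddAbove
  obtain ⟨φ, hφ, hφbox⟩ := square_exists_potential_of_finite_support (a := a) (b := b)
    (isCochain_rhombusCochain hc) (fun p => by rw [curl_rhombusCochain hc, hcurl, hcurl, add_zero])
    fun p hp k => by
      have hpR (d : Bool) : (p, d) ∉ R := fun h => by
        have hfst := Finset.mem_image_of_mem Prod.fst h
        exact hp (Finset.mem_Icc.2 ⟨ha hfst, hb hfst⟩)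
      fin_cases k <;> exact hsupp _ (hpR _) _
  have hgrad (f : Triangle) (k : Fin 3) : triangleSides.grad φ (f, k) = c (f, k) :=
    triangle_grad_eq_of_rhombus (hcurl f) (fun k => congrFun hφ (f.1, k)) k
  refine ⟨φ, funext fun x => hgrad x.1 x.2, fun f hf k =>
    hR.eq_zero_outside triangleSides ?_ ?_ hf k⟩
  · refine ((Finset.Icc (a - 1) b) ×ˢ Finset.univ).finite_toSet.subset ?_
    rintro ⟨p, d⟩ ⟨k, hk⟩
    have hmem := not_imp_comm.1 (hφbox _) hk
    simp only [Finset.coe_product, Finset.coe_Icc, Finset.coe_univ, Set.mem_prod, Set.mem_Icc,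
      Set.mem_univ, and_true]
    cases d <;> fin_cases k <;>
      simp [triangleSides, Prod.le_def] at hmem ⊢ <;> omega
  · intro f hf
    have hnext (k : Fin 3) :
        φ (triangleSides.corner f (triangleSides.next k)) = φ (triangleSides.corner f k) :=
      sub_eq_zero.1 ((hgrad f k).trans (hsupp f hf k))
    have hconst (k : Fin 3) : φ (triangleSides.corner f k) = φ (triangleSides.corner f 0) := by
      fin_cases k
      exacts [rfl, hnext 0, (hnext 2).symm]
    exact fun j k => (hconst j).trans (hconst k).symm

end Potential

/-- A colouring of the faces by black and white in which adjacent faces differ. -/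
def IsProperColouring {F : Type} (V : F → Finset (ℤ × ℤ)) (black : F → Prop) : Prop :=
  ∀ f g, (faceGraph V).Adj f g → (black f ↔ ¬black g)

theorem isProperColouring_squareBlack : IsProperColouring squareCorners squareBlack := by
  rintro ⟨x, y⟩ g hfg
  simp only [squareBlack, Int.even_iff]
  rcases square_adj_iff.1 hfg with rfl | rfl | rfl | rfl <;> dsimp only <;> omega

theorem isProperColouring_triangleBlack : IsProperColouring triangleCorners triangleBlack := by
  rintro f g hfg
  rcases triangle_adj_iff.1 hfg with ⟨hf, rfl | rfl | rfl⟩ | ⟨hf, rfl | rfl | rfl⟩ <;>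
    simp [triangleBlack, hf]

section Labelling

variable {F K A : Type} {V : F → Finset (ℤ × ℤ)} {black : F → Prop} {R : Finset F} {n : ℕ}
  [AddCommGroup A]

namespace Labelling

variable (ℓ : Labelling black R n)

theorem face_injective : Function.Injective fun x => (ℓ.face x).1 :=
  Subtype.val_injective.comp ℓ.face.injective

theorem exists_face {f : F} (hf : f ∈ R) : ∃ x, (ℓ.face x).1 = f :=
  ⟨ℓ.face.symm ⟨f, hf⟩, by rw [Equiv.apply_symm_apply]⟩

theorem exists_inl {f : F} (hf : f ∈ R) (hb : black f) : ∃ i, (ℓ.face (Sum.inl i)).1 = f := by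
  obtain ⟨i | j, rfl⟩ := ℓ.exists_face hf
  exacts [⟨i, rfl⟩, absurd hb (ℓ.white_inr j)]

theorem exists_inr {f : F} (hf : f ∈ R) (hb : ¬black f) : ∃ j, (ℓ.face (Sum.inr j)).1 = f := by
  obtain ⟨i | j, rfl⟩ := ℓ.exists_face hf
  exacts [absurd (ℓ.black_inl i) hb, ⟨j, rfl⟩]

variable [DecidableEq F]

theorem B_apply (i j : Fin n) : ℓ.B V i j =
    if (faceGraph V).Adj (ℓ.face (Sum.inl i)).1 (ℓ.face (Sum.inr j)).1 then 1 else 0 :=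
  SimpleGraph.adjMatrix_apply ..

/-- The function on faces which is `g j` at the `j`-th white face, and zero elsewhere. -/
def extend (g : Fin n → A) (f : F) : A :=
  ∑ j, if (ℓ.face (Sum.inr j)).1 = f then g j else 0

theorem extend_inr (g : Fin n → A) (j : Fin n) : ℓ.extend g (ℓ.face (Sum.inr j)).1 = g j := by
  simp only [extend, ℓ.face_injective.eq_iff, Sum.inr.injEq, Finset.sum_ite_eq',
    Finset.mem_univ, if_true]

theorem extend_of_notMem (g : Fin n → A) {f : F} (hf : f ∉ R) : ℓ.extend g f = 0 :=
  Finset.sum_eq_zero fun j _ => if_neg <| by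
    rintro rfl
    exact hf (ℓ.face (Sum.inr j)).2

theorem sum_extend_across [Fintype K] (S : Sides V K) (g : Fin n → A) (i : Fin n) :
    ∑ k, ℓ.extend g (S.across ((ℓ.face (Sum.inl i)).1, k)).1 = ∑ j, ℓ.B V i j • g j := by
  simp only [extend]
  rw [Finset.sum_comm]
  refine Finset.sum_congr rfl fun j _ => ?_
  rw [ℓ.B_apply, ite_smul, one_smul, zero_smul]
  split_ifs with hadj
  · obtain ⟨k, hk⟩ := (S.adj_iff _ _).1 hadj
    rw [Fintype.sum_eq_single k fun k' hk' => if_neg fun h =>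
      hk' (S.across_injective _ (h.symm.trans hk.symm)), if_pos hk.symm]
  · exact Finset.sum_eq_zero fun k _ => if_neg fun h => hadj ((S.adj_iff _ _).2 ⟨k, h.symm⟩)

end Labelling

end Labelling

section SquareDeterminant

variable {A A' : Type} [AddCommGroup A] [AddCommGroup A']

theorem square_grad_alternating_iff {φ : ℤ × ℤ → A} {f : Square} {ε : ℤˣ} {a : A} :
    (∀ k, squareSides.grad φ (f, k) = ε • ![a, -a, a, -a] k) ↔
      φ (squareSides.corner f 1) - φ (squareSides.corner f 0) = ε • a ∧
      φ (squareSides.corner f 2) = φ (squareSides.corner f 0) ∧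
      φ (squareSides.corner f 3) = φ (squareSides.corner f 1) := by
  have hgrad (k : Fin 4) : squareSides.grad φ (f, k) =
    φ (squareSides.corner f (finRotate 4 k)) - φ (squareSides.corner f k) := rfl
  constructor
  · intro h
    have h0 : φ (squareSides.corner f 1) - φ (squareSides.corner f 0) = ε • a := h 0
    have h1 : φ (squareSides.corner f 2) - φ (squareSides.corner f 1) = ε • -a := h 1
    have h2 : φ (squareSides.corner f 3) - φ (squareSides.corner f 2) = ε • a := h 2
    refine ⟨h0, ?_, ?_⟩
    · rw [← sub_eq_zero, ← sub_add_sub_cancel, h1, h0, smul_neg, neg_add_cancel]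
    · rw [← sub_eq_zero, ← sub_add_sub_cancel, h2, h1, smul_neg, add_neg_cancel]
  · rintro ⟨h1, h2, h3⟩ k
    rw [hgrad]
    fin_cases k <;> simp [h2, h3, ← h1]

variable {R : Finset Square} {n : ℕ}
  (ℓ : Labelling squareBlack R n) {φ : ℤ × ℤ → A} {g : Fin n → A}

instance : DecidablePred squareBlack := fun s => inferInstanceAs (Decidable (Even (s.1 + s.2)))

namespace Labelling

/-- The cochain attached to a vector `g` indexed by the white faces: up to sign, its value on each
of the four sides of the `j`-th white face is `g j`, and it vanishes on sides with no white face
of the region. -/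
def kernelCochain (g : Fin n → A) (x : Square × Fin 4) : A :=
  x.1.2.negOnePow • if squareBlack x.1 then ℓ.extend g (squareSides.across x).1
    else ![ℓ.extend g x.1, -ℓ.extend g x.1, ℓ.extend g x.1, -ℓ.extend g x.1] x.2

theorem isCochain_kernelCochain (g : Fin n → A) : squareSides.IsCochain (ℓ.kernelCochain g) := by
  refine square_isCochain_iff.2 fun f => ?_
  have hup : squareBlack (f.1, f.2 + 1) ↔ ¬squareBlack f := by
    simp only [squareBlack, ← add_assoc, Int.even_add_one]
  have hright : squareBlack (f.1 + 1, f.2) ↔ ¬squareBlack f := by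
    simp only [squareBlack, add_right_comm, Int.even_add_one]
  by_cases hf : squareBlack f <;>
    simp [kernelCochain, squareSides, hup, hright, hf, Int.negOnePow_succ]

theorem kernelCochain_inr (g : Fin n → A) (j : Fin n) (k : Fin 4) :
    ℓ.kernelCochain g ((ℓ.face (Sum.inr j)).1, k) =
      (ℓ.face (Sum.inr j)).1.2.negOnePow • ![g j, -g j, g j, -g j] k := by
  rw [kernelCochain, if_neg (ℓ.white_inr j), ℓ.extend_inr]

theorem curl_kernelCochain_of_white (g : Fin n → A) {f : Square} (hf : ¬squareBlack f) :
    curl (ℓ.kernelCochain g) f = 0 := by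
  simp [curl, Fin.sum_univ_four, kernelCochain, hf]

theorem curl_kernelCochain_inl (g : Fin n → A) (i : Fin n) :
    curl (ℓ.kernelCochain g) (ℓ.face (Sum.inl i)).1 =
      (ℓ.face (Sum.inl i)).1.2.negOnePow • ∑ j, ℓ.B squareCorners i j • g j := by
  rw [← ℓ.sum_extend_across squareSides, Finset.smul_sum]
  simp only [curl, kernelCochain, ℓ.black_inl i, if_true]

/-- Up to signs and additive constants, the functions `φ` correspond to the elements `g` of the
kernel of `B`. -/
def IsKernelPotential (g : Fin n → A) (φ : ℤ × ℤ → A) : Prop :=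
  ∀ f ∈ R, ∀ k, squareSides.grad φ (f, k) = ℓ.kernelCochain g (f, k)

theorem exists_isKernelPotential (hR : HoleFree squareCorners R)
    (hg : ∀ i, ∑ j, ℓ.B squareCorners i j • g j = 0) : ∃ φ, ℓ.IsKernelPotential g φ := by
  refine square_exists_potential hR (ℓ.isCochain_kernelCochain g) fun f hf => ?_
  by_cases hb : squareBlack f
  · obtain ⟨i, rfl⟩ := ℓ.exists_inl hf hb
    rw [curl_kernelCochain_inl, hg, smul_zero]
  · exact ℓ.curl_kernelCochain_of_white g hb

variable {ℓ}

theorem IsKernelPotential.sum_smul_eq_zero (hφ : ℓ.IsKernelPotential g φ) (i : Fin n) :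
    ∑ j, ℓ.B squareCorners i j • g j = 0 := by
  rw [← smul_eq_zero_iff_eq (ℓ.face (Sum.inl i)).1.2.negOnePow, ← curl_kernelCochain_inl,
    ← squareSides.curl_grad φ (ℓ.face (Sum.inl i)).1]
  exact Finset.sum_congr rfl fun k _ => (hφ _ (ℓ.face _).2 k).symm

/-- A potential takes only two values on a white face, at opposite corners the same one, and is
constant along the sides with no white face. -/
theorem isKernelPotential_iff : ℓ.IsKernelPotential g φ ↔
    (∀ j, φ (squareSides.corner (ℓ.face (Sum.inr j)).1 1) -
        φ (squareSides.corner (ℓ.face (Sum.inr j)).1 0) =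
          (ℓ.face (Sum.inr j)).1.2.negOnePow • g j ∧
      φ (squareSides.corner (ℓ.face (Sum.inr j)).1 2) =
        φ (squareSides.corner (ℓ.face (Sum.inr j)).1 0) ∧
      φ (squareSides.corner (ℓ.face (Sum.inr j)).1 3) =
        φ (squareSides.corner (ℓ.face (Sum.inr j)).1 1)) ∧
    ∀ x, x.1 ∈ R → squareBlack x.1 → (squareSides.across x).1 ∉ R →
      φ (squareSides.corner x.1 (squareSides.next x.2)) = φ (squareSides.corner x.1 x.2) := by
  simp only [← square_grad_alternating_iff, ← kernelCochain_inr]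
  constructor
  · intro hφ
    refine ⟨fun j => hφ _ (ℓ.face (Sum.inr j)).2, fun x hx hb hout => ?_⟩
    have h := hφ x.1 hx x.2
    rwa [kernelCochain, if_pos hb, ℓ.extend_of_notMem g hout, smul_zero, Sides.grad,
      sub_eq_zero] at h
  · rintro ⟨hwhite, hout⟩ f hf k
    by_cases hb : squareBlack f
    · by_cases hR : (squareSides.across (f, k)).1 ∈ R
      · obtain ⟨j, hj⟩ := ℓ.exists_inr hR
          ((isProperColouring_squareBlack _ _ (squareSides.adj_across (f, k))).1 hb)
        have h := hwhite j (squareSides.across (f, k)).2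
        rwa [hj, squareSides.isCochain_grad φ, ℓ.isCochain_kernelCochain g, neg_inj] at h
      · rw [Sides.grad, hout (f, k) hf hb hR, sub_self, kernelCochain, if_pos hb,
          ℓ.extend_of_notMem g hR, smul_zero]
    · obtain ⟨j, rfl⟩ := ℓ.exists_inr hf hb
      exact hwhite j k

/-- The characterization of potentials is by equalities between values, which survive any
substitution of values, additive or not. -/
theorem IsKernelPotential.comp (hφ : ℓ.IsKernelPotential g φ) (e : A → A') :
    ℓ.IsKernelPotential (fun j => (ℓ.face (Sum.inr j)).1.2.negOnePow •
      (e (φ (squareSides.corner (ℓ.face (Sum.inr j)).1 1)) -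
        e (φ (squareSides.corner (ℓ.face (Sum.inr j)).1 0)))) (e ∘ φ) := by
  obtain ⟨hwhite, hout⟩ := isKernelPotential_iff.1 hφ
  refine isKernelPotential_iff.2 ⟨fun j => ⟨?_, congrArg e (hwhite j).2.1,
    congrArg e (hwhite j).2.2⟩, fun x hx hb hR => congrArg e (hout x hx hb hR)⟩
  rw [smul_smul, Int.units_mul_self, one_smul, Function.comp_apply, Function.comp_apply]

end Labelling

theorem square_det_eq_zero (hR : HoleFree squareCorners R) (hg : g ≠ 0)
    (hker : ∀ i, ∑ j, ℓ.B squareCorners i j • g j = 0) : (ℓ.B squareCorners).det = 0 := by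
  classical
  obtain ⟨φ, hφ⟩ := ℓ.exists_isKernelPotential hR hker
  obtain ⟨j₀, hj₀⟩ := Function.ne_iff.1 hg
  let corner := squareSides.corner (ℓ.face (Sum.inr j₀)).1
  have hne : φ (corner 0) ≠ φ (corner 1) := fun h => by
    have hsub := ((Labelling.isKernelPotential_iff.1 hφ).1 j₀).1
    exact hj₀ ((smul_eq_zero_iff_eq _).1 (hsub.symm.trans (sub_eq_zero.2 h.symm)))
  have hψ := hφ.comp (Pi.single (φ (corner 1)) (1 : ℤ))
  refine Matrix.exists_mulVec_eq_zero_iff.1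
    ⟨_, Function.ne_iff.2 ⟨j₀, ?_⟩, funext hψ.sum_smul_eq_zero⟩
  simp [corner, hne, Units.smul_def]

theorem square_abs_det_le_one (hR : HoleFree squareCorners R) :
    |(ℓ.B squareCorners).det| ≤ 1 := by
  by_contra! hdet
  obtain ⟨q, hq, hdvd⟩ := Nat.exists_prime_and_dvd (n := (ℓ.B squareCorners).det.natAbs) fun h => by
    rw [Int.abs_eq_natAbs, h] at hdet
    exact lt_irrefl _ hdet
  have := Fact.mk hq
  have hmod : ((ℓ.B squareCorners).map (Int.castRingHom (ZMod q))).det = 0 := by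
    rw [← RingHom.mapMatrix_apply, ← RingHom.map_det, eq_intCast,
      ZMod.intCast_zmod_eq_zero_iff_dvd]
    exact Int.natCast_dvd.2 hdvd
  obtain ⟨g, hg, hker⟩ := Matrix.exists_mulVec_eq_zero_iff.2 hmod
  have hzero := square_det_eq_zero ℓ hR hg fun i => by
    simpa [Matrix.mulVec, dotProduct, zsmul_eq_mul] using congrFun hker i
  simp [hzero] at hdet

end SquareDeterminant

namespace Labelling

variable {F : Type} [DecidableEq F] {V : F → Finset (ℤ × ℤ)} {black : F → Prop} {R : Finset F}
  {n : ℕ} (ℓ : Labelling black R n)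

/-- The permutations whose monomials in the expansion of `det B` do not vanish. -/
def IsMatching (V : F → Finset (ℤ × ℤ)) (σ : Equiv.Perm (Fin n)) : Prop :=
  ∀ i, (faceGraph V).Adj (ℓ.face (Sum.inl i)).1 (ℓ.face (Sum.inr (σ i))).1

instance : DecidablePred (ℓ.IsMatching V) := fun _ => inferInstanceAs (Decidable (∀ _, _))

theorem det_B : (ℓ.B V).det = ∑ σ with ℓ.IsMatching V σ, (Equiv.Perm.sign σ : ℤ) := by
  rw [← Matrix.det_transpose, Matrix.det_apply', Finset.sum_filter]
  refine Finset.sum_congr rfl fun σ _ => ?_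
  simp only [Matrix.transpose_apply, B_apply, Finset.prod_boole, Finset.mem_univ, true_imp_iff]
  rw [mul_ite, mul_one, mul_zero]
  rfl

/-- The pair of the `i`-th black and the `j`-th white face. -/
def pair (i j : Fin n) : Finset F :=
  {(ℓ.face (Sum.inl i)).1, (ℓ.face (Sum.inr j)).1}

theorem face_mem_pair {x : Fin n ⊕ Fin n} {i j : Fin n} :
    (ℓ.face x).1 ∈ ℓ.pair i j ↔ x = Sum.inl i ∨ x = Sum.inr j := by
  simp only [pair, Finset.mem_insert, Finset.mem_singleton, ℓ.face_injective.eq_iff]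

theorem face_mem_pair_apply {x : Fin n ⊕ Fin n} {σ : Equiv.Perm (Fin n)} {i : Fin n} :
    (ℓ.face x).1 ∈ ℓ.pair i (σ i) ↔ i = Sum.elim id σ.symm x := by
  rcases x with j | j <;> simp [face_mem_pair, Equiv.eq_symm_apply, eq_comm]

theorem pair_subset (i j : Fin n) : ℓ.pair i j ⊆ R :=
  Finset.insert_subset (ℓ.face _).2 (Finset.singleton_subset_iff.2 (ℓ.face _).2)

/-- The permutation `σ` corresponds to the tiling `T`. -/
def Describes (σ : Equiv.Perm (Fin n)) (T : Tiling V R) : Prop :=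
  ∀ i, ℓ.pair i (σ i) ∈ T.1.parts

variable {ℓ}

theorem Describes.unique_perm {T : Tiling V R} {σ τ : Equiv.Perm (Fin n)}
    (hσ : ℓ.Describes σ T) (hτ : ℓ.Describes τ T) : σ = τ := by
  ext1 i
  have hmem {j : Fin n} : (ℓ.face (Sum.inl i)).1 ∈ ℓ.pair i j := ℓ.face_mem_pair.2 (Or.inl rfl)
  have hpair : ℓ.pair i (σ i) = ℓ.pair i (τ i) := T.1.eq_of_mem_parts (hσ i) (hτ i) hmem hmem
  have hmem' : (ℓ.face (Sum.inr (σ i))).1 ∈ ℓ.pair i (τ i) :=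
    hpair ▸ ℓ.face_mem_pair.2 (Or.inr rfl)
  simpa only [face_mem_pair, reduceCtorEq, false_or, Sum.inr.injEq] using hmem'

theorem Describes.parts_subset {T T' : Tiling V R} {σ : Equiv.Perm (Fin n)}
    (hT : ℓ.Describes σ T) (hT' : ℓ.Describes σ T') : T.1.parts ⊆ T'.1.parts := by
  intro t ht
  obtain ⟨f, hf⟩ := T.1.nonempty_of_mem_parts ht
  obtain ⟨x, rfl⟩ := ℓ.exists_face (T.1.le ht hf)
  rw [T.1.eq_of_mem_parts ht (hT _) hf (ℓ.face_mem_pair_apply.2 rfl)]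
  exact hT' _

theorem Describes.unique_tiling {T T' : Tiling V R} {σ : Equiv.Perm (Fin n)}
    (hT : ℓ.Describes σ T) (hT' : ℓ.Describes σ T') : T = T' :=
  Subtype.ext (Finpartition.ext ((hT.parts_subset hT').antisymm (hT'.parts_subset hT)))

theorem adj_of_isTile_pair {i j : Fin n} (h : IsTile V (ℓ.pair i j)) :
    (faceGraph V).Adj (ℓ.face (Sum.inl i)).1 (ℓ.face (Sum.inr j)).1 := by
  obtain ⟨f, g, hfg, heq⟩ := h
  rw [pair, ← Finset.coe_inj, Finset.coe_pair, Finset.coe_pair, Set.pair_eq_pair_iff] at heq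
  rcases heq with ⟨rfl, rfl⟩ | ⟨rfl, rfl⟩
  exacts [hfg, hfg.symm]

theorem Describes.isMatching {T : Tiling V R} {σ : Equiv.Perm (Fin n)}
    (hT : ℓ.Describes σ T) : ℓ.IsMatching V σ :=
  fun i => adj_of_isTile_pair (T.2 _ (hT i))

theorem IsMatching.exists_describes {σ : Equiv.Perm (Fin n)} (hσ : ℓ.IsMatching V σ) :
    ∃ T : Tiling V R, ℓ.Describes σ T := by
  let parts := Finset.univ.image fun i => ℓ.pair i (σ i)
  have hparts {t : Finset F} : t ∈ parts ↔ ∃ i, ℓ.pair i (σ i) = t := by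
    simp only [parts, Finset.mem_image, Finset.mem_univ, true_and]
  have hcover : ∀ f ∈ R, ∃! t, t ∈ parts ∧ f ∈ t := fun f hf => by
    obtain ⟨x, rfl⟩ := ℓ.exists_face hf
    refine ⟨_, ⟨hparts.2 ⟨_, rfl⟩, ℓ.face_mem_pair_apply.2 rfl⟩, ?_⟩
    rintro t ⟨ht, hx⟩
    obtain ⟨i, rfl⟩ := hparts.1 ht
    rw [ℓ.face_mem_pair_apply.1 hx]
  refine ⟨⟨Finpartition.ofExistsUnique parts ?_ hcover ?_, ?_⟩, fun i => hparts.2 ⟨i, rfl⟩⟩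
  · rintro t ht
    obtain ⟨i, rfl⟩ := hparts.1 ht
    exact ℓ.pair_subset _ _
  · intro h
    obtain ⟨i, hi⟩ := hparts.1 h
    exact Finset.insert_ne_empty _ _ hi
  · intro t ht
    obtain ⟨i, rfl⟩ := hparts.1 ht
    exact ⟨_, _, hσ i, rfl⟩

theorem exists_pair_mem_parts (hV : IsProperColouring V black) (T : Tiling V R) (i : Fin n) :
    ∃ j, ℓ.pair i j ∈ T.1.parts := by
  have hi := (ℓ.face (Sum.inl i)).2
  obtain ⟨g, hg, hpart⟩ : ∃ g, (faceGraph V).Adj (ℓ.face (Sum.inl i)).1 g ∧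
      T.1.part (ℓ.face (Sum.inl i)).1 = {(ℓ.face (Sum.inl i)).1, g} := by
    have hmem := T.1.mem_part hi
    obtain ⟨f, g, hfg, h⟩ := T.2 _ (T.1.part_mem.2 hi)
    rw [h, Finset.mem_insert, Finset.mem_singleton] at hmem
    rcases hmem with hf | hg
    · exact ⟨g, hf ▸ hfg, hf ▸ h⟩
    · exact ⟨f, hg ▸ hfg.symm, hg ▸ h.trans (Finset.pair_comm f g)⟩
  have hmem := hpart ▸ T.1.part_mem.2 hi
  obtain ⟨j, rfl⟩ := ℓ.exists_inr (T.1.le hmem (by simp)) ((hV _ _ hg).1 (ℓ.black_inl i))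
  exact ⟨j, hmem⟩

variable (ℓ)

theorem exists_describes (hV : IsProperColouring V black) (T : Tiling V R) :
    ∃ σ, ℓ.Describes σ T := by
  choose s hs using ℓ.exists_pair_mem_parts hV T
  have hinj : Function.Injective s := fun i j hij => by
    have hpair : ℓ.pair i (s i) = ℓ.pair j (s j) := T.1.eq_of_mem_parts (hs i) (hs j)
      (ℓ.face_mem_pair.2 (Or.inr rfl)) (ℓ.face_mem_pair.2 (Or.inr (congrArg Sum.inr hij)))
    have hmem : (ℓ.face (Sum.inl i)).1 ∈ ℓ.pair j (s j) :=
      hpair ▸ ℓ.face_mem_pair.2 (Or.inl rfl)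
    simpa only [face_mem_pair, reduceCtorEq, or_false, Sum.inl.injEq] using hmem
  exact ⟨Equiv.ofBijective s (Finite.injective_iff_bijective.1 hinj), hs⟩

theorem exists_tiling_equiv (hV : IsProperColouring V black) :
    ∃ e : Tiling V R ≃ {σ // ℓ.IsMatching V σ}, ∀ T, ℓ.Describes (e T).1 T := by
  choose s hs using ℓ.exists_describes (V := V) hV
  refine ⟨Equiv.ofBijective (fun T => ⟨s T, (hs T).isMatching⟩) ⟨fun T T' h => ?_, ?_⟩, hs⟩
  · have h' : s T = s T' := congrArg Subtype.val h
    exact (hs T).unique_tiling (h' ▸ hs T')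
  · rintro ⟨σ, hσ⟩
    obtain ⟨T, hT⟩ := hσ.exists_describes
    exact ⟨T, Subtype.ext ((hs T).unique_perm hT)⟩

theorem natCard_tiling (hV : IsProperColouring V black) :
    Nat.card (Tiling V R) = (Finset.univ.filter (ℓ.IsMatching V)).card := by
  obtain ⟨e, -⟩ := ℓ.exists_tiling_equiv hV
  rw [Nat.card_congr e, Nat.card_eq_fintype_card, Fintype.card_subtype]

theorem ncard_signClass (hV : IsProperColouring V black) (ε : ℤˣ) :
    (signClass V ℓ ε).ncard =
      (Finset.univ.filter fun σ => ℓ.IsMatching V σ ∧ Equiv.Perm.sign σ = ε).card := by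
  obtain ⟨e, he⟩ := ℓ.exists_tiling_equiv hV
  have hmem (T : Tiling V R) : T ∈ signClass V ℓ ε ↔ Equiv.Perm.sign (e T).1 = ε := by
    refine ⟨fun ⟨σ, hσ, hT⟩ => ?_, fun h => ⟨_, h, he T⟩⟩
    rwa [(he T).unique_perm hT]
  rw [← Fintype.card_subtype, ← Nat.card_eq_fintype_card]
  exact Nat.card_congr ((e.subtypeEquiv hmem).trans (Equiv.subtypeSubtypeEquivSubtypeInter _ _))

theorem det_B_eq_sub (hV : IsProperColouring V black) :
    (ℓ.B V).det = ((signClass V ℓ 1).ncard : ℤ) - ((signClass V ℓ (-1)).ncard : ℤ) := by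
  rw [det_B, ncard_signClass ℓ hV, ncard_signClass ℓ hV, ← Finset.filter_filter,
    ← Finset.filter_filter, Finset.natCast_card_filter, Finset.natCast_card_filter,
    ← Finset.sum_sub_distrib]
  refine Finset.sum_congr rfl fun σ _ => ?_
  rcases Int.units_eq_one_or (Equiv.Perm.sign σ) with h | h <;> rw [h] <;> rfl

end Labelling

section TileFlow

variable {F K : Type} {V : F → Finset (ℤ × ℤ)} {black : F → Prop} {R : Finset F} {n : ℕ}

/-- The sign of a face: `1` for black faces and `-1` for white ones. -/
def colourSign (black : F → Prop) [DecidablePred black] (f : F) : ℤ :=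
  if black f then 1 else -1

namespace Labelling

/-- The involution of the labels which exchanges the two faces of each pair of the matching `σ`. -/
def partner (σ : Equiv.Perm (Fin n)) : Fin n ⊕ Fin n → Fin n ⊕ Fin n :=
  Sum.elim (Sum.inr ∘ σ) (Sum.inl ∘ σ.symm)

theorem partner_partner (σ : Equiv.Perm (Fin n)) (x : Fin n ⊕ Fin n) :
    partner σ (partner σ x) = x := by
  rcases x with i | j
  exacts [congrArg Sum.inl (σ.symm_apply_apply i), congrArg Sum.inr (σ.apply_symm_apply j)]

/-- The faces `f` and `g` form a pair of the matching `σ`, in either order. -/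
def Matched (ℓ : Labelling black R n) (σ : Equiv.Perm (Fin n)) (f g : F) : Prop :=
  ∃ x, (ℓ.face x).1 = f ∧ (ℓ.face (partner σ x)).1 = g

variable {ℓ : Labelling black R n} {S : Sides V K} {σ τ : Equiv.Perm (Fin n)} {f g : F}

theorem matched_face {x : Fin n ⊕ Fin n} :
    ℓ.Matched σ (ℓ.face x).1 g ↔ (ℓ.face (partner σ x)).1 = g := by
  simp only [Matched, ℓ.face_injective.eq_iff, exists_eq_left]

theorem Matched.symm (h : ℓ.Matched σ f g) : ℓ.Matched σ g f := by
  obtain ⟨x, rfl, rfl⟩ := h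
  rw [matched_face, partner_partner]

theorem Matched.left_mem (h : ℓ.Matched σ f g) : f ∈ R := by
  obtain ⟨x, rfl, -⟩ := h
  exact (ℓ.face x).2

theorem IsMatching.adj_partner (hσ : ℓ.IsMatching V σ) (x : Fin n ⊕ Fin n) :
    (faceGraph V).Adj (ℓ.face x).1 (ℓ.face (partner σ x)).1 := by
  rcases x with i | j
  · exact hσ i
  · have h := hσ (σ.symm j)
    rw [Equiv.apply_symm_apply] at h
    exact h.symm

theorem IsMatching.exists_across_eq (hσ : ℓ.IsMatching V σ) (S : Sides V K)
    (x : Fin n ⊕ Fin n) : ∃ k, (S.across ((ℓ.face x).1, k)).1 = (ℓ.face (partner σ x)).1 :=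
  (S.adj_iff _ _).1 (hσ.adj_partner x)

variable [DecidablePred black]

theorem Matched.colourSign_eq_neg (h : ℓ.Matched σ f g) :
    colourSign black g = -colourSign black f := by
  obtain ⟨i | j, rfl, rfl⟩ := h <;>
    simp [colourSign, partner, ℓ.black_inl, ℓ.white_inr]

variable [DecidableEq F]

instance (σ : Equiv.Perm (Fin n)) (f g : F) : Decidable (ℓ.Matched σ f g) :=
  inferInstanceAs (Decidable (∃ _, _ ∧ _))

variable (ℓ S) in
/-- The flow which carries one unit from the black to the white face of each pair of `σ`. -/
def tileFlow (σ : Equiv.Perm (Fin n)) (x : F × K) : ℤ :=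
  if ℓ.Matched σ x.1 (S.across x).1 then colourSign black x.1 else 0

theorem isCochain_tileFlow : S.IsCochain (ℓ.tileFlow S σ) := by
  intro x
  rw [tileFlow, tileFlow, S.across_across]
  by_cases h : ℓ.Matched σ x.1 (S.across x).1
  · rw [if_pos h, if_pos h.symm, h.colourSign_eq_neg]
  · rw [if_neg h, if_neg fun h' => h h'.symm, neg_zero]

theorem tileFlow_of_notMem (hf : f ∉ R) (k : K) : ℓ.tileFlow S σ (f, k) = 0 :=
  if_neg fun h => hf h.left_mem

theorem tileFlow_face [DecidableEq K] {x : Fin n ⊕ Fin n} {k₀ : K}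
    (h : (S.across ((ℓ.face x).1, k₀)).1 = (ℓ.face (partner σ x)).1) (k : K) :
    ℓ.tileFlow S σ ((ℓ.face x).1, k) = if k₀ = k then colourSign black (ℓ.face x).1 else 0 := by
  simp only [tileFlow, matched_face, ← h, (S.across_injective _).eq_iff]

theorem curl_tileFlow [Fintype K] (hσ : ℓ.IsMatching V σ) (f : F) :
    curl (ℓ.tileFlow S σ) f = if f ∈ R then colourSign black f else 0 := by
  classical
  split_ifs with hf
  · obtain ⟨x, rfl⟩ := ℓ.exists_face hf
    obtain ⟨k₀, hk₀⟩ := hσ.exists_across_eq S x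
    simp only [curl, tileFlow_face hk₀, Finset.sum_ite_eq, Finset.mem_univ, if_true]
  · exact Finset.sum_eq_zero fun k _ => tileFlow_of_notMem hf k

theorem eq_of_tileFlow_eq (hσ : ℓ.IsMatching V σ) (h : ℓ.tileFlow S σ = ℓ.tileFlow S τ) :
    σ = τ := by
  classical
  ext1 i
  obtain ⟨k, hk⟩ := hσ.exists_across_eq S (Sum.inl i)
  have hne : ℓ.tileFlow S τ ((ℓ.face (Sum.inl i)).1, k) ≠ 0 := by
    rw [← h, tileFlow_face hk, if_pos rfl, colourSign, if_pos (ℓ.black_inl i)]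
    exact one_ne_zero
  have hτ := matched_face.1 (not_not.1 fun hnot => hne (if_neg hnot))
  exact (Sum.inr_injective (ℓ.face_injective (hτ.trans hk))).symm

end Labelling

end TileFlow

section TriangleDeterminant

variable {R : Finset Triangle} {n : ℕ} {ℓ : Labelling triangleBlack R n}
  {σ τ : Equiv.Perm (Fin n)} {v : ℤ × ℤ}

instance : DecidablePred triangleBlack := fun t => inferInstanceAs (Decidable (t.2 = true))

/-- The black triangles with a corner `v`; this is the corner `k` of `blackAt v k`. -/
def blackAt (v : ℤ × ℤ) : Fin 3 → Triangle :=
  ![(v, true), ((v.1 - 1, v.2), true), ((v.1, v.2 - 1), true)]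

theorem triangleBlack_blackAt (v : ℤ × ℤ) (k : Fin 3) : triangleBlack (blackAt v k) := by
  fin_cases k <;> rfl

theorem triangle_corner_eq_iff {f : Triangle} (hf : triangleBlack f) {k : Fin 3} :
    triangleSides.corner f k = v ↔ f = blackAt v k := by
  obtain ⟨⟨a, b⟩, c⟩ := f
  obtain rfl : c = true := hf
  fin_cases k <;> simp [triangleSides, blackAt, Prod.ext_iff] <;> omega

theorem blackAt_injective (v : ℤ × ℤ) : Function.Injective (blackAt v) := by
  intro j k h
  fin_cases j <;> fin_cases k <;> simp [blackAt, Prod.ext_iff] at h ⊢ <;> omega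

theorem triangle_grad_single {f : Triangle} (hf : triangleBlack f) (v : ℤ × ℤ) (k : Fin 3) :
    triangleSides.grad (Pi.single v (1 : ℤ)) (f, k) =
      (if f = blackAt v (triangleSides.next k) then 1 else 0) -
        if f = blackAt v k then 1 else 0 := by
  simp only [Sides.grad, Pi.single_apply, triangle_corner_eq_iff hf]

/-- Each of the three white triangles around `v` is a neighbour of two of the black ones. -/
theorem across_blackAt_next (v : ℤ × ℤ) (k : Fin 3) :
    (triangleSides.across (blackAt v (triangleSides.next k), triangleSides.next k)).1 =
      (triangleSides.across (blackAt v k, triangleSides.next (triangleSides.next k))).1 := by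
  fin_cases k <;> simp [triangleSides, blackAt]

namespace Labelling

/-- A height function of the tiling `σ`: around each black face it increases by `1` along the
sides that are not crossed by a tile and decreases by `2` along the side that is. -/
def IsHeight (ℓ : Labelling triangleBlack R n) (σ : Equiv.Perm (Fin n)) (h : ℤ × ℤ → ℤ) : Prop :=
  ∀ f ∈ R, ∀ k, triangleSides.grad h (f, k) =
    colourSign triangleBlack f - 3 * ℓ.tileFlow triangleSides σ (f, k)

theorem IsMatching.exists_isHeight (hσ : ℓ.IsMatching triangleCorners σ)
    (hR : HoleFree triangleCorners R) : ∃ h, ℓ.IsHeight σ h := by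
  refine triangle_exists_potential (c := fun x => colourSign triangleBlack x.1 -
    3 * ℓ.tileFlow triangleSides σ x) hR (fun x => ?_) fun f hf => ?_
  · have hsign : colourSign triangleBlack (triangleSides.across x).1 =
        -colourSign triangleBlack x.1 := by
      have hcolour := isProperColouring_triangleBlack _ _ (triangleSides.adj_across x)
      by_cases hx : triangleBlack (triangleSides.across x).1 <;> simp [colourSign, hcolour, hx]
    simp only [isCochain_tileFlow x, hsign]
    ring
  · have hcurl : ∑ k, ℓ.tileFlow triangleSides σ (f, k) = colourSign triangleBlack f :=
      (curl_tileFlow hσ f).trans (if_pos hf)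
    simp only [curl, Finset.sum_sub_distrib, ← Finset.mul_sum, hcurl]
    simp

/-- `w` is the height difference, in units of three, of the tilings `τ` and `σ`. -/
structure IsHeightDifference (ℓ : Labelling triangleBlack R n) (σ τ : Equiv.Perm (Fin n))
    (w : ℤ × ℤ → ℤ) : Prop where
  grad_eq : triangleSides.grad w = ℓ.tileFlow triangleSides τ - ℓ.tileFlow triangleSides σ
  eq_zero : ∀ f ∉ R, ∀ k, w (triangleSides.corner f k) = 0

theorem IsHeightDifference.neg {w : ℤ × ℤ → ℤ} (hw : ℓ.IsHeightDifference σ τ w) :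
    ℓ.IsHeightDifference τ σ (-w) where
  grad_eq := by
    rw [← neg_sub, ← hw.grad_eq]
    exact funext fun x => (neg_sub_neg _ _).trans (neg_sub _ _).symm
  eq_zero f hf k := neg_eq_zero.2 (hw.eq_zero f hf k)

theorem IsMatching.exists_isHeightDifference (hR : HoleFree triangleCorners R)
    (hσ : ℓ.IsMatching triangleCorners σ) (hτ : ℓ.IsMatching triangleCorners τ) :
    ∃ w, ℓ.IsHeightDifference σ τ w := by
  obtain ⟨w, hw, hw0⟩ := triangle_exists_interior_potential hR
    (isCochain_tileFlow.sub isCochain_tileFlow)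
    (c := ℓ.tileFlow triangleSides τ - ℓ.tileFlow triangleSides σ)
    (fun f => by rw [curl_sub, curl_tileFlow hσ, curl_tileFlow hτ, sub_self])
    fun f hf k => by rw [Pi.sub_apply, tileFlow_of_notMem hf, tileFlow_of_notMem hf, sub_self]
  exact ⟨w, hw, hw0⟩

namespace IsHeightDifference

variable {w : ℤ × ℤ → ℤ} (hw : ℓ.IsHeightDifference σ τ w)
include hw

theorem mem_of_corner_ne_zero {f : Triangle} {k : Fin 3}
    (h : w (triangleSides.corner f k) ≠ 0) : f ∈ R :=
  not_not.1 fun hf => h (hw.eq_zero f hf k)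

theorem mem_image_fst_of_ne_zero (hv : w v ≠ 0) : v ∈ R.image Prod.fst :=
  Finset.mem_image.2 ⟨(v, true), hw.mem_of_corner_ne_zero (k := 0) hv, rfl⟩

/-- If a black side starting at `v` is not crossed by a tile of `σ`, then its other end is higher
for `σ` and no lower in comparison with `τ`; so `v` is chosen to maximize first `w`, then the
height. -/
theorem exists_vertex_forall_matched (hR : HoleFree triangleCorners R)
    (hσ : ℓ.IsMatching triangleCorners σ) {v₀ : ℤ × ℤ} (hv₀ : 0 < w v₀) :
    ∃ v, 0 < w v ∧ ∀ f k, triangleBlack f → triangleSides.corner f k = v →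
      ℓ.Matched σ f (triangleSides.across (f, k)).1 := by
  obtain ⟨h, hh⟩ := hσ.exists_isHeight hR
  obtain ⟨v, -, hmax⟩ := (R.image Prod.fst).exists_max_image (fun v => toLex (w v, h v))
    ⟨v₀, hw.mem_image_fst_of_ne_zero hv₀.ne'⟩
  simp only [Prod.Lex.toLex_le_toLex] at hmax
  have hwv : 0 < w v := by
    have := hmax v₀ (hw.mem_image_fst_of_ne_zero hv₀.ne')
    omega
  refine ⟨v, hwv, ?_⟩
  rintro f k hf rfl
  by_contra hnot
  set v' := triangleSides.corner f (triangleSides.next k)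
  have hσ0 : ℓ.tileFlow triangleSides σ (f, k) = 0 := if_neg hnot
  have hτ0 : 0 ≤ ℓ.tileFlow triangleSides τ (f, k) := by
    rw [tileFlow, colourSign, if_pos hf]
    split_ifs <;> decide
  have hwv' : w (triangleSides.corner f k) ≤ w v' := by
    have := congrFun hw.grad_eq (f, k)
    rw [Pi.sub_apply, hσ0, sub_zero] at this
    exact sub_nonneg.1 (hτ0.trans_eq this.symm)
  have hhv' : h v' - h (triangleSides.corner f k) = 1 := by
    have := hh f (hw.mem_of_corner_ne_zero hwv.ne') k
    rwa [hσ0, colourSign, if_pos hf] at this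
  have := hmax v' (hw.mem_image_fst_of_ne_zero (hwv.trans_le hwv').ne')
  omega

end IsHeightDifference

theorem eq_of_forall_black {c d : Triangle × Fin 3 → ℤ} (hc : triangleSides.IsCochain c)
    (hd : triangleSides.IsCochain d) (h : ∀ f k, triangleBlack f → c (f, k) = d (f, k)) :
    c = d := by
  ext x
  by_cases hx : triangleBlack x.1
  · exact h x.1 x.2 hx
  · have := h _ (triangleSides.across x).2 <|
      (isProperColouring_triangleBlack _ _ (triangleSides.adj_across x).symm).2 hx
    rwa [hc, hd, neg_inj] at this

/-- In the matching `σ`, the three black triangles around `v`, labelled by `e`, are paired with the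
three white ones, each across the side that starts at `v`. -/
structure IsStar (ℓ : Labelling triangleBlack R n) (σ : Equiv.Perm (Fin n)) (v : ℤ × ℤ)
    (e : Fin 3 ↪ Fin n) : Prop where
  face_inl : ∀ k, (ℓ.face (Sum.inl (e k))).1 = blackAt v k
  across_eq : ∀ k, (triangleSides.across (blackAt v k, k)).1 = (ℓ.face (Sum.inr (σ (e k)))).1

theorem exists_isStar
    (hv : ∀ f k, triangleBlack f → triangleSides.corner f k = v →
      ℓ.Matched σ f (triangleSides.across (f, k)).1) : ∃ e, ℓ.IsStar σ v e := by
  have hmatched (k : Fin 3) := hv (blackAt v k) k (triangleBlack_blackAt v k)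
    ((triangle_corner_eq_iff (triangleBlack_blackAt v k)).2 rfl)
  choose i hi using fun k => ℓ.exists_inl (hmatched k).left_mem (triangleBlack_blackAt v k)
  refine ⟨⟨i, fun j k h => blackAt_injective v (by rw [← hi, ← hi, h])⟩, hi, fun k => ?_⟩
  have hpair := hmatched k
  rw [← hi, matched_face, hi] at hpair
  exact hpair.symm

/-- The rotation of three tiles with a common vertex, whose black faces are labelled by `e`. -/
def rotate (σ : Equiv.Perm (Fin n)) (e : Fin 3 ↪ Fin n) : Equiv.Perm (Fin n) :=
  σ * (triangleSides.next).viaFintypeEmbedding e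

theorem sign_rotate (σ : Equiv.Perm (Fin n)) (e : Fin 3 ↪ Fin n) :
    Equiv.Perm.sign (rotate σ e) = Equiv.Perm.sign σ := by
  rw [rotate, map_mul, Equiv.Perm.viaFintypeEmbedding_sign]
  exact mul_one _

namespace IsStar

variable {e : Fin 3 ↪ Fin n} (he : ℓ.IsStar σ v e)
include he

theorem across_rotate (k : Fin 3) :
    (triangleSides.across (blackAt v k, triangleSides.next (triangleSides.next k))).1 =
      (ℓ.face (Sum.inr (rotate σ e (e k)))).1 := by
  rw [← across_blackAt_next, he.across_eq]
  exact congrArg (fun a => (ℓ.face (Sum.inr (σ a))).1)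
    (Equiv.Perm.viaFintypeEmbedding_apply_image _ e k).symm

theorem rotate_apply_of_notMem {a : Fin n} (ha : (ℓ.face (Sum.inl a)).1 ∉ Set.range (blackAt v)) :
    rotate σ e a = σ a :=
  congrArg σ <| Equiv.Perm.viaFintypeEmbedding_apply_notMem_range _ e <| by
    rintro ⟨k, rfl⟩
    exact ha ⟨k, (he.face_inl k).symm⟩

theorem isMatching_rotate (hσ : ℓ.IsMatching triangleCorners σ) :
    ℓ.IsMatching triangleCorners (rotate σ e) := fun a => by
  by_cases ha : (ℓ.face (Sum.inl a)).1 ∈ Set.range (blackAt v)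
  · obtain ⟨k, hk⟩ := ha
    obtain rfl : e k = a := Sum.inl_injective (ℓ.face_injective ((he.face_inl k).trans hk))
    rw [he.face_inl]
    exact (triangleSides.adj_iff _ _).2 ⟨_, he.across_rotate k⟩
  · rw [he.rotate_apply_of_notMem ha]
    exact hσ a

theorem tileFlow_rotate_sub :
    ℓ.tileFlow triangleSides (rotate σ e) - ℓ.tileFlow triangleSides σ =
      triangleSides.grad (Pi.single v 1) := by
  refine eq_of_forall_black (isCochain_tileFlow.sub isCochain_tileFlow)
    (triangleSides.isCochain_grad _) fun f k hf => ?_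
  rw [triangle_grad_single hf, Pi.sub_apply]
  by_cases hfv : f ∈ Set.range (blackAt v)
  · obtain ⟨j, rfl⟩ := hfv
    have hnext : triangleSides.next (triangleSides.next j) = k ↔ j = triangleSides.next k := by
      clear hf
      decide +revert
    have hσ := he.across_eq j
    have hrot := he.across_rotate j
    rw [← he.face_inl] at hσ hrot
    rw [← he.face_inl, tileFlow_face (x := Sum.inl (e j)) hrot,
      tileFlow_face (x := Sum.inl (e j)) hσ, he.face_inl]
    simp only [(blackAt_injective v).eq_iff, colourSign, if_pos hf, hnext]
  · rw [if_neg fun h => hfv ⟨_, h.symm⟩, if_neg fun h => hfv ⟨_, h.symm⟩, sub_eq_sub_iff_add_eq_add,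
      add_zero, zero_add]
    by_cases hR : f ∈ R
    · obtain ⟨a, rfl⟩ := ℓ.exists_inl hR hf
      simp only [tileFlow, matched_face, partner, Sum.elim_inl, Function.comp_apply,
        he.rotate_apply_of_notMem hfv]
    · rw [tileFlow_of_notMem hR, tileFlow_of_notMem hR]

end IsStar

theorem IsHeightDifference.exists_smaller (hR : HoleFree triangleCorners R) {w : ℤ × ℤ → ℤ}
    (hw : ℓ.IsHeightDifference σ τ w) (hσ : ℓ.IsMatching triangleCorners σ) {v₀ : ℤ × ℤ}
    (hv₀ : 0 < w v₀) : ∃ ρ w', ℓ.IsMatching triangleCorners ρ ∧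
      Equiv.Perm.sign ρ = Equiv.Perm.sign σ ∧ ℓ.IsHeightDifference ρ τ w' ∧
      ∑ v ∈ R.image Prod.fst, (w' v).natAbs < ∑ v ∈ R.image Prod.fst, (w v).natAbs := by
  obtain ⟨v, hwv, hv⟩ := hw.exists_vertex_forall_matched hR hσ hv₀
  obtain ⟨e, he⟩ := exists_isStar hv
  refine ⟨rotate σ e, w - Pi.single v 1, he.isMatching_rotate hσ, sign_rotate σ e, ⟨?_, ?_⟩, ?_⟩
  · have hsub : triangleSides.grad (w - Pi.single v 1) =
        triangleSides.grad w - triangleSides.grad (Pi.single v 1) :=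
      funext fun x => sub_sub_sub_comm ..
    rw [hsub, hw.grad_eq, ← he.tileFlow_rotate_sub, sub_sub_sub_cancel_right]
  · intro f hf k
    have hne : triangleSides.corner f k ≠ v := by
      rintro rfl
      exact hwv.ne' (hw.eq_zero f hf k)
    rw [Pi.sub_apply, Pi.single_eq_of_ne hne, hw.eq_zero f hf, sub_zero]
  · refine Finset.sum_lt_sum (fun u _ => ?_) ⟨v, hw.mem_image_fst_of_ne_zero hwv.ne', ?_⟩
    · rcases eq_or_ne u v with rfl | hu
      · rw [Pi.sub_apply, Pi.single_eq_same]
        omega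
      · rw [Pi.sub_apply, Pi.single_eq_of_ne hu, sub_zero]
    · rw [Pi.sub_apply, Pi.single_eq_same]
      omega

theorem IsHeightDifference.sign_eq (hR : HoleFree triangleCorners R)
    (hσ : ℓ.IsMatching triangleCorners σ) (hτ : ℓ.IsMatching triangleCorners τ) {w : ℤ × ℤ → ℤ}
    (hw : ℓ.IsHeightDifference σ τ w) : Equiv.Perm.sign σ = Equiv.Perm.sign τ := by
  induction hN : ∑ v ∈ R.image Prod.fst, (w v).natAbs using Nat.strong_induction_on
    generalizing σ τ w with
  | _ N ih =>
    subst hN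
    by_cases hw0 : ∀ v, w v = 0
    · have hflow : ℓ.tileFlow triangleSides σ = ℓ.tileFlow triangleSides τ := by
        rw [eq_comm, ← sub_eq_zero, ← hw.grad_eq]
        exact funext fun x => sub_eq_zero.2 ((hw0 _).trans (hw0 _).symm)
      rw [eq_of_tileFlow_eq hσ hflow]
    push Not at hw0
    obtain ⟨v, hv⟩ := hw0
    wlog hpos : 0 < w v generalizing σ τ w
    · refine (this hτ hσ hw.neg ?_ ?_ ?_).symm
      · simpa using ih
      · exact neg_ne_zero.2 hv
      · exact neg_pos.2 (hv.lt_of_le (not_lt.1 hpos))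
    obtain ⟨ρ, w', hρ, hsign, hw', hlt⟩ := hw.exists_smaller hR hσ hpos
    exact hsign.symm.trans (ih _ hlt hρ hτ hw' rfl)

theorem sign_eq_of_isMatching (hR : HoleFree triangleCorners R)
    (hσ : ℓ.IsMatching triangleCorners σ) (hτ : ℓ.IsMatching triangleCorners τ) :
    Equiv.Perm.sign σ = Equiv.Perm.sign τ := by
  obtain ⟨w, hw⟩ := hσ.exists_isHeightDifference hR hτ
  exact hw.sign_eq hR hσ hτ

end Labelling

theorem triangle_abs_det_eq_natCard (ℓ : Labelling triangleBlack R n)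
    (hR : HoleFree triangleCorners R) :
    |(ℓ.B triangleCorners).det| = (Nat.card (Tiling triangleCorners R) : ℤ) := by
  rw [ℓ.det_B, ℓ.natCard_tiling isProperColouring_triangleBlack]
  rcases isEmpty_or_nonempty {σ // ℓ.IsMatching triangleCorners σ} with hempty | ⟨σ, hσ⟩
  · rw [isEmpty_subtype] at hempty
    simp [hempty]
  · rw [Finset.sum_congr rfl fun τ hτ => by
      rw [Labelling.sign_eq_of_isMatching hR (Finset.mem_filter.1 hτ).2 hσ], Finset.sum_const,
      nsmul_eq_mul, abs_mul, Nat.abs_cast, Int.abs_eq_natAbs, Int.units_natAbs, Nat.cast_one,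
      mul_one]

theorem triangle_signClass_eq_empty (ℓ : Labelling triangleBlack R n)
    (hR : HoleFree triangleCorners R) :
    signClass triangleCorners ℓ 1 = ∅ ∨ signClass triangleCorners ℓ (-1) = ∅ := by
  by_contra! hne
  obtain ⟨⟨T, σ, hσ, hT⟩, T', τ, hτ, hT'⟩ := hne
  have hσT : ℓ.Describes σ T := hT
  have hτT : ℓ.Describes τ T' := hT'
  have hsign := Labelling.sign_eq_of_isMatching hR hσT.isMatching hτT.isMatching
  rw [hσ, hτ] at hsign
  exact absurd hsign (by decide)

end TriangleDeterminant

end Tilings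

open Tilings in
theorem theorem2p2_general :
    (∀ (R : Finset Square), HoleFree squareCorners R →
      ∀ (n : ℕ) (ℓ : Labelling squareBlack R n),
        |(ℓ.B squareCorners).det| ≤ 1 ∧
        |((signClass squareCorners ℓ 1).ncard : ℤ) -
          ((signClass squareCorners ℓ (-1)).ncard : ℤ)| ≤ 1) ∧
    (∀ (R : Finset Triangle), HoleFree triangleCorners R →
      ∀ (n : ℕ) (ℓ : Labelling triangleBlack R n),
        |(ℓ.B triangleCorners).det| = (Nat.card (Tiling triangleCorners R) : ℤ) ∧
        (signClass triangleCorners ℓ 1 = ∅ ∨ signClass triangleCorners ℓ (-1) = ∅)) := by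
  refine ⟨fun R hR n ℓ => ?_, fun R hR n ℓ =>
    ⟨triangle_abs_det_eq_natCard ℓ hR, triangle_signClass_eq_empty ℓ hR⟩⟩
  have hdet := square_abs_det_le_one ℓ hR
  exact ⟨hdet, ℓ.det_B_eq_sub isProperColouring_squareBlack ▸ hdet⟩

open Tilings in
theorem theorem2p2 :
    (∀ (R : Finset Square), IsSimplyConnected (body squareCorners squarePt R) →
      ∀ (n : ℕ) (ℓ : Labelling squareBlack R n),
        |(ℓ.B squareCorners).det| ≤ 1 ∧
        |((signClass squareCorners ℓ 1).ncard : ℤ) -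
          ((signClass squareCorners ℓ (-1)).ncard : ℤ)| ≤ 1) ∧
    (∀ (R : Finset Triangle), IsSimplyConnected (body triangleCorners trianglePt R) →
      ∀ (n : ℕ) (ℓ : Labelling triangleBlack R n),
        |(ℓ.B triangleCorners).det| = (Nat.card (Tiling triangleCorners R) : ℤ) ∧
        (signClass triangleCorners ℓ 1 = ∅ ∨ signClass triangleCorners ℓ (-1) = ∅)) := by
  exact ⟨fun R hR => theorem2p2_general.1 R (square_holeFree hR),
    fun R hR => theorem2p2_general.2 R (triangle_holeFree hR)⟩
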